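/- \textbf{Setting.} Let $P=(p_{xy})$ be the transition matrix of an irreducible (possibly non-reversible) Markov chain on a finite set $X$ with stationary distribution $\pi$, let $P^*=(p^*_{yx})$ with $\pi_x p_{xy}=\pi_y p^*_{yx}$ be the time-reversed chain, let $\bar 0\in X$, and let $M\subseteq X$ be the set of marked elements. Every $x\in X$ comes with data $d(x)$; write $|x\rangle_d=|x,d(x)\rangle$ and $\mathcal H_d=\mathrm{span}\{|x\rangle_d|y\rangle_d : x,y\in X\}$. Three costs $\mathsf S,\mathsf U,\mathsf C\ge 0$ are charged: $\mathsf S$ for constructing the state $\sum_x\sqrt{\pi_x}\,|x\rangle_d|\bar 0\rangle_d$; $\mathsf U$ for each use of one of the two unitaries (or their inverses) that map $|x\rangle_d|\bar 0\rangle_d\mapsto|x\rangle_d\sum_y\sqrt{p_{xy}}\,|y\rangle_d$, respectively $|\bar 0\rangle_d|y\rangle_d\mapsto\sum_x\sqrt{p^*_{yx}}\,|x\rangle_d|y\rangle_d$, and may act arbitrarily on the other basis vectors; $\mathsf C$ for each use (possibly controlled by the workspace) of the phase flip $|x\rangle_d|y\rangle_d\mapsto-|x\rangle_d|y\rangle_d$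 for $x\in M$, and for checking whether an observed element is marked. Unitary operations on a finite-dimensional workspace, also when controlled by whether the first or the second register is $|\bar 0\rangle_d$, are not charged. A quantum search algorithm is a finite sequence of runs; in a run the state $\sum_x\sqrt{\pi_x}\,|x\rangle_d|\bar 0\rangle_d$ is constructed next to a fixed basis state of a workspace, a fixed finite sequence of the above operations is applied, the first register is observed, and the observed element is checked. The algorithm outputs the first observed element that is marked, and "no marked element exists" if there is none. \textbf{Theorem.} For every $\eta>0$ there is a constant $\kappa>0$ such that for all $\delta,\varepsilon>0$ there is a quantum search algorithm, not depending on $X$, $P$, $M$ and $d$ otherwise than through the operations above, of total cost at most $$\kappa\left(\mathsf S+\frac1{\sqrt\varepsilon}\left(\frac1{\sqrt\delta}\,\mathsf U+\mathsf C\right)\right)$$ for all $\mathsf S,\mathsf U,\mathsf C\ge 0$, with the following property. Let $P$ be an irreducible Markov chain on a finite set $X$ whose discriminant $D(P)=\mathrm{diag}(\pi)^{1/2}\,P\,\mathrm{diag}(\pi)^{-1/2}$ has exactly one singular value (counted with multiplicity) equal to $1$, and whose singular value gap, that is $1$ minus the second largest singular value of $D(P)$ (taken to be $0$ if $|X|=1$),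 is $\delta$. Let $M\subseteq X$ satisfy $\sum_{x\in M}\pi_x\ge\varepsilon$ whenever $M\neq\emptyset$. Then with probability at least $1-\eta$ the output of the algorithm is an element of $M$ if $M\ne\emptyset$, and "no marked element exists" if $M=\emptyset$. -/

import Mathlib

open scoped Kronecker Matrix

namespace QuantumSearch

noncomputable section

/-! ### Markov chains -/

section Chain

variable {X : Type*} [Fintype X] [DecidableEq X]

/-- `pi` is a stationary distribution of the chain with transition matrix `P`. -/
def IsStationaryDistribution (P : Matrix X X ℝ) (pi : X → ℝ) : Prop :=
  pi ∈ stdSimplex ℝ X ∧ pi ᵥ* P = pi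

/-- The time-reversed chain `P*`, defined by `pi x * P x y = pi y * P* y x`. -/
def timeReversal (P : Matrix X X ℝ) (pi : X → ℝ) : Matrix X X ℝ :=
  Matrix.of fun y x => pi x * P x y / pi y

/-- The discriminant `D(P) = diag(pi)^{1/2} P diag(pi)^{-1/2}`. -/
def discriminant (P : Matrix X X ℝ) (pi : X → ℝ) : Matrix X X ℝ :=
  Matrix.diagonal (fun x => √(pi x)) * P * Matrix.diagonal (fun x => (√(pi x))⁻¹)

/-- The singular values of a square matrix in decreasing order, repeated according to
multiplicity; indices run from `0`, and from the size of the matrix on the values are `0`. -/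
def singularValue (D : Matrix X X ℝ) (i : ℕ) : ℝ :=
  (Matrix.toEuclideanLin D).singularValues i

/-- Exactly one singular value of `D`, counted with multiplicity, is equal to `1`. -/
def HasExactlyOneUnitSingularValue (D : Matrix X X ℝ) : Prop :=
  ∃! i : ℕ, i < Fintype.card X ∧ singularValue D i = 1

/-- The singular value gap: the distance from `1` to the second largest singular value.
It is `1` for a `1 × 1` matrix. -/
def singularValueGap (D : Matrix X X ℝ) : ℝ :=
  1 - singularValue D 1

end Chain

/-! ### Registers and black-box operations -/

/-- The set `X_d = {(x, d(x)) : x ∈ X}` of the states of the chain with their data. -/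
structure DataState {X D : Type*} (d : X → D) where
  state : X
  data : D
  data_eq : data = d state

namespace DataState

variable {X D : Type*} {d : X → D}

/-- The bijection of `X_d` with `X`. -/
def equivState (d : X → D) : DataState d ≃ X where
  toFun s := s.state
  invFun x := ⟨x, d x, rfl⟩
  left_inv := by rintro ⟨x, y, rfl⟩; rfl
  right_inv _ := rfl

/-- The state `x` with its data. -/
def of (d : X → D) (x : X) : DataState d := (equivState d).symm x

instance [Fintype X] : Fintype (DataState d) := Fintype.ofEquiv X (equivState d).symm

instance [DecidableEq X] : DecidableEq (DataState d) := (equivState d).decidableEq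

end DataState

/-- The labels of the basis vectors `|x⟩_d |y⟩_d` of the space `ℂ^{X_d × X_d}`. -/
abbrev Edge {X D : Type*} (d : X → D) : Type _ := DataState d × DataState d

/-- The basis vector `|x⟩_d |y⟩_d`. -/
def ket {X D : Type*} [DecidableEq X] (d : X → D) (x y : X) : Edge d → ℂ :=
  Pi.single (DataState.of d x, DataState.of d y) 1

variable {X D : Type*} [Fintype X] [DecidableEq X]

/-- A realization of the two update operations on `ℂ^{X_d × X_d}`: unitary maps with
`|x⟩|0⟩ ↦ |x⟩ ∑_y √p_{xy} |y⟩` and `|0⟩|y⟩ ↦ ∑_x √p*_{yx} |x⟩|y⟩`, and with an arbitrary action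
on the other basis vectors. -/
structure UpdateOracle (d : X → D) (zero : X) (P : Matrix X X ℝ) (pi : X → ℝ) where
  right : Matrix.unitaryGroup (Edge d) ℂ
  left : Matrix.unitaryGroup (Edge d) ℂ
  right_apply : ∀ x : X, right.1 *ᵥ ket d x zero = ∑ y : X, (√(P x y) : ℂ) • ket d x y
  left_apply : ∀ y : X,
    left.1 *ᵥ ket d zero y = ∑ x : X, (√(timeReversal P pi y x) : ℂ) • ket d x y

/-! ### Circuits

The circuits act on `ℂ^{X_d × X_d} ⊗ ℂ^K` with a workspace `ℂ^K`. A circuit is a list of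
instructions that mentions neither the state space, nor the chain, nor the marked set, nor the
data: it has access to these only through the charged operations. -/

/-- Instructions.
* `work V` applies the unitary `V` to the workspace;
* `ifZeroFst V`, `ifZeroSnd V` apply `V` to the workspace if the first, respectively the second,
  register is in the state `|0⟩_d`;
* `updateRight`, `updateLeft` and their inverses are the two update operations;
* `check T` multiplies `|x⟩_d |y⟩_d |k⟩` by `-1` if `x` is marked and `k ∈ T`. -/
inductive Instr (K : Type) [Fintype K] [DecidableEq K] : Type
  | work (V : Matrix.unitaryGroup K ℂ)
  | ifZeroFst (V : Matrix.unitaryGroup K ℂ)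
  | ifZeroSnd (V : Matrix.unitaryGroup K ℂ)
  | updateRight
  | updateRightInv
  | updateLeft
  | updateLeftInv
  | check (T : Finset K)

/-- The cost of an instruction: `U` for an update or its inverse, `C` for a check. Operations on
the workspace and tests for `|0⟩_d` do not depend on the chain, the marked set or the data, and
are free. -/
def Instr.cost {K : Type} [Fintype K] [DecidableEq K] (U C : ℝ) : Instr K → ℝ
  | .work _ => 0
  | .ifZeroFst _ => 0
  | .ifZeroSnd _ => 0
  | .updateRight => U
  | .updateRightInv => U
  | .updateLeft => U
  | .updateLeftInv => U
  | .check _ => C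

/-- The operator `V` on the workspace controlled by the predicate `p` on the registers. -/
def controlled {B K : Type*} [DecidableEq B] [DecidableEq K] (p : B → Prop) [DecidablePred p]
    (V : Matrix K K ℂ) : Matrix (B × K) (B × K) ℂ :=
  Matrix.diagonal (fun b => if p b then 1 else 0) ⊗ₖ V +
    Matrix.diagonal (fun b => if p b then 0 else 1) ⊗ₖ (1 : Matrix K K ℂ)

/-- The operator on `ℂ^{X_d × X_d} ⊗ ℂ^K` that an instruction performs. -/
def Instr.op {K : Type} [Fintype K] [DecidableEq K] {d : X → D} {zero : X}
    {P : Matrix X X ℝ} {pi : X → ℝ} (O : UpdateOracle d zero P pi) (M : Finset X) :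
    Instr K → Matrix (Edge d × K) (Edge d × K) ℂ
  | .work V => (1 : Matrix (Edge d) (Edge d) ℂ) ⊗ₖ V.1
  | .ifZeroFst V => controlled (fun e : Edge d => e.1 = DataState.of d zero) V.1
  | .ifZeroSnd V => controlled (fun e : Edge d => e.2 = DataState.of d zero) V.1
  | .updateRight => O.right.1 ⊗ₖ (1 : Matrix K K ℂ)
  | .updateRightInv => (O.right⁻¹).1 ⊗ₖ (1 : Matrix K K ℂ)
  | .updateLeft => O.left.1 ⊗ₖ (1 : Matrix K K ℂ)
  | .updateLeftInv => (O.left⁻¹).1 ⊗ₖ (1 : Matrix K K ℂ)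
  | .check T => Matrix.diagonal fun s => if s.1.1.state ∈ M ∧ s.2 ∈ T then -1 else 1

/-- A run: construct the state `∑_x √pi_x |x⟩_d |0⟩_d |init⟩`, perform the instructions in order,
observe the first register, and check whether the observed element is marked. -/
structure Run where
  K : Type
  [fintypeK : Fintype K]
  [decEqK : DecidableEq K]
  init : K
  instrs : List (Instr K)

attribute [instance] Run.fintypeK Run.decEqK

namespace Run

/-- The setup, the instructions, and the final check of the observed element. -/
def cost (S U C : ℝ) (r : Run) : ℝ :=
  S + (r.instrs.map (Instr.cost U C)).sum + C

/-- The state `∑_x √pi_x |x⟩_d |0⟩_d |init⟩`. -/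
def initialState (r : Run) (d : X → D) (zero : X) (pi : X → ℝ) : Edge d × r.K → ℂ :=
  fun s => if s.2 = r.init then (∑ x : X, (√(pi x) : ℂ) • ket d x zero) s.1 else 0

variable {d : X → D} {zero : X} {P : Matrix X X ℝ} {pi : X → ℝ}

/-- The state after all the instructions. -/
def finalState (r : Run) (O : UpdateOracle d zero P pi) (M : Finset X) : Edge d × r.K → ℂ :=
  r.instrs.foldl (fun ψ g => g.op O M *ᵥ ψ) (r.initialState d zero pi)

/-- The probability that `x` is observed in the first register at the end. -/
def observeProb (r : Run) (O : UpdateOracle d zero P pi) (M : Finset X) (x : X) : ℝ :=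
  ∑ y : DataState d, ∑ k : r.K, ‖r.finalState O M ((DataState.of d x, y), k)‖ ^ 2

end Run

/-! ### Search algorithms -/

/-- A search algorithm performs finitely many runs one after the other. It stops and outputs the
observed element as soon as that is marked, and outputs `none` ('no marked element exists') if
this happens in no run. -/
abbrev SearchAlgorithm : Type 1 := List Run

namespace SearchAlgorithm

/-- The total cost of all runs. -/
def cost (S U C : ℝ) (alg : SearchAlgorithm) : ℝ :=
  (alg.map (Run.cost S U C)).sum

variable {d : X → D} {zero : X} {P : Matrix X X ℝ} {pi : X → ℝ}

/-- The probability of each output. -/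
def outputProb (O : UpdateOracle d zero P pi) (M : Finset X) :
    SearchAlgorithm → Option X → ℝ
  | [], none => 1
  | [], some _ => 0
  | r :: rs, none => (∑ x ∈ Mᶜ, r.observeProb O M x) * outputProb O M rs none
  | r :: rs, some x =>
      (if x ∈ M then r.observeProb O M x else 0) +
        (∑ z ∈ Mᶜ, r.observeProb O M z) * outputProb O M rs (some x)

/-- The correct outputs: a marked element if there is one, and `none` otherwise. -/
def IsCorrect (M : Finset X) : Option X → Prop
  | none => M = ∅
  | some x => x ∈ M

open Classical in
/-- The probability that the output is correct. -/
def successProb (alg : SearchAlgorithm) (O : UpdateOracle d zero P pi) (M : Finset X) : ℝ :=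
  ∑ o : Option X with IsCorrect M o, outputProb O M alg o

end SearchAlgorithm

end

end QuantumSearch

namespace QuantumSearch

set_option linter.unusedSectionVars false

/-! ### Two subspaces at positive angle, and the product of their reflections -/

section TwoProjections

open scoped InnerProductSpace

variable {E : Type*} [NormedAddCommGroup E] [InnerProductSpace ℂ E]
  {A B : Submodule ℂ E} [A.HasOrthogonalProjection] [B.HasOrthogonalProjection] {p : E} {σ : ℝ}

/-! Let A and B be the spaces spanned by the vectors |x⟩∑√p_xy|y⟩ and ∑√p*_yx|x⟩|y⟩ that the two
updates produce. The inner products between these two families are the entries of D(P). Both spaces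
contain the stationary state p with amplitudes √(π_x p_xy), and the gap says that orthogonally to p
all cosines between A and B are at most 1-δ. The angles are thus of order at least √δ, reversible
chain or not (`UpdateOracle.norm_inner_le`).

Amplitude amplification needs the reflection in p. It is approximated as follows: put a clock into
the uniform superposition of 0, …, N-1, apply that power of the walk W = R_B R_A, apply the inverse
of the preparation, flip the phase of A at the clock start, and undo everything. This sends p to -p
exactly. On h ⊥ p only the A-part of N⁻¹∑Wⁿh is flipped, and its norm is at most ‖h‖/(N√δ)
(`norm_starProjection_sum_walk_le`, `norm_approxReflection_sub_le`). Here h need not lie in A + B,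
which matters because checks lead out of that space.

One recursive step turns a marked amplitude s into (3-4s²)s up to sign, with an error relative to s
(`norm_amplification_sub_le`). Level i has its own clock of length 2^i N₀ with N₀ of order 1/√δ. So
the relative errors 2^-(i+2) are summable, while the growth 3^i of the recursion dominates the clock
lengths: there is no logarithmic factor (`circuitCost_amplify_le`). With 9^L of order 1/√ε, 2L
levels suffice.

The initial amplitude may exceed √ε, so a fixed level could overshoot. A run therefore performs the
levels 0, 2, …, 2L in turn, each time moving the marked part to a flag of its own and undoing the
level. Until the first of these levels with amplitude above 1/16 the amplitudes grow geometrically,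
so the parts removed earlier cost at most half of the amplitude there (`exists_level_of_growth`,
`exists_norm_marked_ge`, `slice_stages`). Each run finds a marked element with probability at least
1/1024, and a number of repetitions depending only on η finishes. -/

theorem inner_starProjection_of_mem (hp : p ∈ A) (u : E) :
    ⟪p, A.starProjection u⟫_ℂ = ⟪p, u⟫_ℂ := by
  rw [← A.inner_starProjection_left_eq_right, Submodule.starProjection_eq_self_iff.2 hp]

/-- Test the cosine bound on the pair a, P_B a, whose inner product is ‖P_B a‖². -/
theorem norm_starProjection_le_of_inner_le (hpB : p ∈ B)
    (hσ : ∀ a ∈ A, ∀ b ∈ B, ⟪p, a⟫_ℂ = 0 → ⟪p, b⟫_ℂ = 0 → ‖⟪a, b⟫_ℂ‖ ≤ σ * ‖a‖ * ‖b‖)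
    {a : E} (ha : a ∈ A) (hpa : ⟪p, a⟫_ℂ = 0) :
    ‖B.starProjection a‖ ^ 2 ≤ σ ^ 2 * ‖a‖ ^ 2 := by
  have h := hσ a ha _ (B.starProjection_apply_mem a) hpa
    (by rw [inner_starProjection_of_mem hpB, hpa])
  have h2 : ⟪a, B.starProjection a⟫_ℂ = (‖B.starProjection a‖ ^ 2 : ℝ) := by
    rw [← Submodule.starProjection_eq_self_iff.2 (B.starProjection_apply_mem a),
      ← B.inner_starProjection_left_eq_right, inner_self_eq_norm_sq_to_K,
      Submodule.starProjection_eq_self_iff.2 (B.starProjection_apply_mem a)]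
    norm_cast
  rw [h2, Complex.norm_real, Real.norm_of_nonneg (by positivity)] at h
  rcases (norm_nonneg (B.starProjection a)).eq_or_lt with h0 | h0
  · rw [← h0, zero_pow two_ne_zero]; positivity
  · have h3 : ‖B.starProjection a‖ ≤ σ * ‖a‖ := by
      rw [sq] at h; exact le_of_mul_le_mul_right h h0
    calc _ ≤ (σ * ‖a‖) ^ 2 := by gcongr
      _ = _ := by ring

theorem norm_sub_starProjection_sq (u : E) :
    ‖u - B.starProjection u‖ ^ 2 = ‖u‖ ^ 2 - ‖B.starProjection u‖ ^ 2 := by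
  rw [B.norm_sq_eq_add_norm_sq_starProjection u, Submodule.starProjection_orthogonal_val]
  ring

/-- With u = a + b, a' = P_A u and w = u - a' = b - P_A b, the difference P_A u - P_B u splits
orthogonally into a' - P_B a' and -P_B w. The first is large since a' ∈ A is far from B, the second
since w is b without its small A-part. -/
theorem norm_starProjection_sub_sq_ge (hpA : p ∈ A) (hpB : p ∈ B)
    (hσ : ∀ a ∈ A, ∀ b ∈ B, ⟪p, a⟫_ℂ = 0 → ⟪p, b⟫_ℂ = 0 → ‖⟪a, b⟫_ℂ‖ ≤ σ * ‖a‖ * ‖b‖)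
    {a b : E} (ha : a ∈ A) (hb : b ∈ B) (hpa : ⟪p, a⟫_ℂ = 0) (hpb : ⟪p, b⟫_ℂ = 0) :
    (1 - σ ^ 2) * ‖a + b‖ ^ 2 ≤
      ‖A.starProjection (a + b) - B.starProjection (a + b)‖ ^ 2 := by
  set a' : E := A.starProjection (a + b) with ha'
  set w : E := (a + b) - a' with hw
  have ha'A : a' ∈ A := A.starProjection_apply_mem _
  have hpa' : ⟪p, a'⟫_ℂ = 0 := by
    rw [ha', inner_starProjection_of_mem hpA, inner_add_right, hpa, hpb, add_zero]
  have hwA : ∀ z ∈ A, ⟪z, w⟫_ℂ = 0 := fun z hz =>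
    (A.sub_starProjection_mem_orthogonal (a + b)) z hz
  have hPw : A.starProjection w = 0 :=
    (A.starProjection_apply_eq_zero_iff).2 (A.sub_starProjection_mem_orthogonal (a + b))
  have hPa' : A.starProjection a' = a' := Submodule.starProjection_eq_self_iff.2 ha'A
  have hwb : w = b - A.starProjection b := by
    rw [hw, ha', map_add, Submodule.starProjection_eq_self_iff.2 ha]; abel
  have hu : a + b = a' + w := by rw [hw]; abel
  have h1 : a' - B.starProjection (a + b) = (a' - B.starProjection a') - B.starProjection w := by
    rw [hu, map_add]; abel
  have horth : ⟪a' - B.starProjection a', B.starProjection w⟫_ℂ = 0 := by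
    rw [← B.inner_starProjection_left_eq_right, map_sub,
      Submodule.starProjection_eq_self_iff.2 (B.starProjection_apply_mem a'), sub_self,
      inner_zero_left]
  have horth2 : ⟪a', w⟫_ℂ = 0 := hwA _ ha'A
  have h2 : ‖a' - B.starProjection (a + b)‖ ^ 2 =
      ‖a' - B.starProjection a'‖ ^ 2 + ‖B.starProjection w‖ ^ 2 := by
    rw [h1, @norm_sub_sq ℂ, horth]; simp
  have h3 : ‖a + b‖ ^ 2 = ‖a'‖ ^ 2 + ‖w‖ ^ 2 := by
    rw [hu, @norm_add_sq ℂ, horth2]; simp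
  have h4 : (1 - σ ^ 2) * ‖a'‖ ^ 2 ≤ ‖a' - B.starProjection a'‖ ^ 2 := by
    rw [norm_sub_starProjection_sq]
    linarith [norm_starProjection_le_of_inner_le hpB hσ ha'A hpa']
  have h5 : (1 - σ ^ 2) * ‖b‖ ^ 2 ≤ ‖w‖ ^ 2 := by
    rw [hwb, norm_sub_starProjection_sq]
    have := norm_starProjection_le_of_inner_le (A := B) (B := A) (σ := σ) hpA
      (fun x hx y hy h h' => by
        rw [← norm_inner_symm, mul_right_comm]; exact hσ y hy x hx h' h) hb hpb
    linarith
  -- As w ⊥ A, the inner product of b and P_B w is that of b and w, namely ‖w‖². Combined with h5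
  -- this bounds P_B w from below once ‖b‖² is cancelled.
  have h6 : ‖w‖ ^ 2 ≤ ‖b‖ * ‖B.starProjection w‖ := by
    have h : ⟪b, B.starProjection w⟫_ℂ = (‖w‖ ^ 2 : ℝ) := by
      rw [← B.inner_starProjection_left_eq_right, Submodule.starProjection_eq_self_iff.2 hb,
        show b = w + A.starProjection b by rw [hwb]; abel, inner_add_left,
        hwA _ (A.starProjection_apply_mem b), add_zero, inner_self_eq_norm_sq_to_K]
      norm_cast
    have h' := norm_inner_le_norm (𝕜 := ℂ) b (B.starProjection w)
    rwa [h, Complex.norm_real, Real.norm_of_nonneg (by positivity)] at h'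
  have h7 : (1 - σ ^ 2) * ‖w‖ ^ 2 ≤ ‖B.starProjection w‖ ^ 2 := by
    rcases (norm_nonneg b).eq_or_lt with h0 | h0
    · have : ‖w‖ ^ 2 = 0 := le_antisymm (by simpa [← h0] using h6) (by positivity)
      rw [this]; simp
    · refine le_of_mul_le_mul_right ?_ (by positivity : 0 < ‖b‖ ^ 2)
      calc (1 - σ ^ 2) * ‖w‖ ^ 2 * ‖b‖ ^ 2 = (1 - σ ^ 2) * ‖b‖ ^ 2 * ‖w‖ ^ 2 := by ring
        _ ≤ ‖w‖ ^ 2 * ‖w‖ ^ 2 := by gcongr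
        _ ≤ (‖b‖ * ‖B.starProjection w‖) * (‖b‖ * ‖B.starProjection w‖) := by gcongr
        _ = _ := by ring
  rw [h2, h3]; linarith

variable (A B) in
/-- The product of the reflections in two subspaces. -/
noncomputable def walk : E ≃ₗᵢ[ℂ] E := B.reflection * A.reflection

theorem walk_inv : (walk A B)⁻¹ = A.reflection * B.reflection := by
  rw [walk, mul_inv_rev, Submodule.reflection_inv, Submodule.reflection_inv]

/-- Because R_A² = 1, R_A R_B - 1 = R_A (R_B - R_A), and reflections differ by twice the difference
of the projections. -/
theorem norm_walk_inv_sub (u : E) :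
    ‖(walk A B)⁻¹ u - u‖ = 2 * ‖A.starProjection u - B.starProjection u‖ := by
  have h : (walk A B)⁻¹ u - u = A.reflection (B.reflection u - A.reflection u) := by
    rw [walk_inv, map_sub, Submodule.reflection_reflection]; rfl
  rw [h, LinearIsometryEquiv.norm_map, Submodule.reflection_apply, Submodule.reflection_apply,
    sub_sub_sub_cancel_right, ← smul_sub, ← Nat.cast_smul_eq_nsmul ℂ, norm_smul, norm_sub_rev]
  simp

theorem walk_apply_of_mem (hpA : p ∈ A) (hpB : p ∈ B) : walk A B p = p := by
  change B.reflection (A.reflection p) = p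
  rw [A.reflection_mem_subspace_eq_self hpA, B.reflection_mem_subspace_eq_self hpB]

theorem pow_apply_of_fixed {U : E ≃ₗᵢ[ℂ] E} (h : U p = p) (n : ℕ) : (U ^ n) p = p := by
  induction n with
  | zero => rfl
  | succ n ih => rw [pow_succ]; change (U ^ n) (U p) = p; rw [h, ih]

variable (A B p) in
/-- The sum of the parts of two subspaces that are orthogonal to `p`. -/
noncomputable def orthogonalSum : Submodule ℂ E := (A ⊓ (ℂ ∙ p)ᗮ) ⊔ (B ⊓ (ℂ ∙ p)ᗮ)

/-- The part in A is fixed; the part in B changes sign and gains twice its projection to A, which is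
still orthogonal to p because p ∈ A. -/
theorem reflection_mem_orthogonalSum_left (hpA : p ∈ A) {u : E}
    (hu : u ∈ orthogonalSum A B p) : A.reflection u ∈ orthogonalSum A B p := by
  obtain ⟨a, ha, b, hb, rfl⟩ := Submodule.mem_sup.1 hu
  rw [map_add, A.reflection_mem_subspace_eq_self ha.1, Submodule.reflection_apply]
  refine add_mem (Submodule.mem_sup_left ha) (sub_mem ?_ (Submodule.mem_sup_right hb))
  have h : A.starProjection b ∈ A ⊓ (ℂ ∙ p)ᗮ := by
    refine ⟨A.starProjection_apply_mem b, ?_⟩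
    rw [SetLike.mem_coe, Submodule.mem_orthogonal_singleton_iff_inner_right,
      inner_starProjection_of_mem hpA]
    exact Submodule.mem_orthogonal_singleton_iff_inner_right.1 hb.2
  exact nsmul_mem (Submodule.mem_sup_left h) 2

theorem walk_inv_pow_mem_orthogonalSum (hpA : p ∈ A) (hpB : p ∈ B) {u : E}
    (hu : u ∈ orthogonalSum A B p) (n : ℕ) :
    ((walk A B)⁻¹ ^ n) u ∈ orthogonalSum A B p := by
  induction n with
  | zero => exact hu
  | succ n ih =>
    rw [pow_succ', walk_inv] at *
    refine reflection_mem_orthogonalSum_left hpA ?_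
    have := reflection_mem_orthogonalSum_left (A := B) (B := A) hpB
      (u := ((A.reflection * B.reflection) ^ n) u)
    rw [orthogonalSum, sup_comm] at this
    exact this ih

/-- The sum s telescopes: W⁻¹s - s = W⁻ᴺa - a has norm at most 2‖a‖, whereas W⁻¹ - 1 is bounded
below by 2√δ on `orthogonalSum`, which contains s. -/
theorem norm_sum_walk_inv_le {δ : ℝ} (hδ1 : δ ≤ 1) (hδ : 0 < δ) (hpA : p ∈ A) (hpB : p ∈ B)
    (hσ : ∀ a ∈ A, ∀ b ∈ B, ⟪p, a⟫_ℂ = 0 → ⟪p, b⟫_ℂ = 0 → ‖⟪a, b⟫_ℂ‖ ≤ (1 - δ) * ‖a‖ * ‖b‖)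
    {a : E} (ha : a ∈ A) (hpa : ⟪p, a⟫_ℂ = 0) (N : ℕ) :
    √δ * ‖∑ n ∈ Finset.range N, ((walk A B)⁻¹ ^ n) a‖ ≤ ‖a‖ := by
  set s := ∑ n ∈ Finset.range N, ((walk A B)⁻¹ ^ n) a with hs
  have haL : a ∈ orthogonalSum A B p := Submodule.mem_sup_left
    ⟨ha, Submodule.mem_orthogonal_singleton_iff_inner_right.2 hpa⟩
  have hsL : s ∈ orthogonalSum A B p :=
    sum_mem fun n _ => walk_inv_pow_mem_orthogonalSum hpA hpB haL n
  have htel : (walk A B)⁻¹ s - s = ((walk A B)⁻¹ ^ N) a - a := by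
    rw [hs, map_sum, ← Finset.sum_sub_distrib]
    have := Finset.sum_range_sub (fun n => ((walk A B)⁻¹ ^ n) a) N
    rw [pow_zero] at this
    rw [← show _ = ((walk A B)⁻¹ ^ N) a - a from this]
    refine Finset.sum_congr rfl fun n _ => ?_
    rw [pow_succ']; rfl
  have h1 : ‖(walk A B)⁻¹ s - s‖ ≤ 2 * ‖a‖ := by
    rw [htel]
    refine (norm_sub_le _ _).trans ?_
    rw [LinearIsometryEquiv.norm_map]; linarith
  rw [norm_walk_inv_sub] at h1
  obtain ⟨x, hx, y, hy, hxy⟩ := Submodule.mem_sup.1 hsL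
  have h2 := norm_starProjection_sub_sq_ge hpA hpB hσ hx.1 hy.1
    (Submodule.mem_orthogonal_singleton_iff_inner_right.1 hx.2)
    (Submodule.mem_orthogonal_singleton_iff_inner_right.1 hy.2)
  rw [hxy] at h2
  refine abs_le_of_sq_le_sq' ?_ (norm_nonneg a) |>.2
  rw [mul_pow, Real.sq_sqrt hδ.le]
  have h3 : ‖A.starProjection s - B.starProjection s‖ ^ 2 ≤ ‖a‖ ^ 2 := by
    gcongr; linarith
  -- 1 - (1-δ)² = δ(2-δ) ≥ δ.
  have h4 : δ * ‖s‖ ^ 2 ≤ (1 - (1 - δ) ^ 2) * ‖s‖ ^ 2 := by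
    gcongr; nlinarith
  linarith

/-- Dual to `norm_sum_walk_inv_le`: only the test vector lies in A, so h may leave A + B. On the
complement of A + B the walk is the identity and the sum is Nh, but its A-part vanishes; projecting
to A is essential. -/
theorem norm_starProjection_sum_walk_le {δ : ℝ} (hδ1 : δ ≤ 1) (hδ : 0 < δ) (hpA : p ∈ A)
    (hpB : p ∈ B)
    (hσ : ∀ a ∈ A, ∀ b ∈ B, ⟪p, a⟫_ℂ = 0 → ⟪p, b⟫_ℂ = 0 → ‖⟪a, b⟫_ℂ‖ ≤ (1 - δ) * ‖a‖ * ‖b‖)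
    {h : E} (hph : ⟪p, h⟫_ℂ = 0) (N : ℕ) :
    √δ * ‖A.starProjection (∑ n ∈ Finset.range N, ((walk A B) ^ n) h)‖ ≤ ‖h‖ := by
  set a := A.starProjection (∑ n ∈ Finset.range N, ((walk A B) ^ n) h) with ha
  have haA : a ∈ A := A.starProjection_apply_mem _
  have hadj : ∀ (n : ℕ) (x y : E), ⟪x, ((walk A B) ^ n) y⟫_ℂ = ⟪((walk A B)⁻¹ ^ n) x, y⟫_ℂ := by
    intro n x y
    rw [← LinearIsometryEquiv.inner_map_map ((walk A B) ^ n) (((walk A B)⁻¹ ^ n) x) y,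
      inv_pow]
    exact congrArg (fun z => ⟪z, ((walk A B) ^ n) y⟫_ℂ)
      (((walk A B) ^ n).apply_symm_apply x).symm
  have hfix : (walk A B)⁻¹ p = p := by
    conv_lhs => rw [← walk_apply_of_mem hpA hpB]
    exact (walk A B).symm_apply_apply p
  have hpa : ⟪p, a⟫_ℂ = 0 := by
    rw [ha, inner_starProjection_of_mem hpA, inner_sum]
    refine Finset.sum_eq_zero fun n _ => ?_
    rw [hadj, pow_apply_of_fixed hfix, hph]
  have hkey := norm_sum_walk_inv_le hδ1 hδ hpA hpB hσ haA hpa N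
  have hsq : ‖a‖ ^ 2 ≤ ‖∑ n ∈ Finset.range N, ((walk A B)⁻¹ ^ n) a‖ * ‖h‖ := by
    have h1 : ⟪∑ n ∈ Finset.range N, ((walk A B)⁻¹ ^ n) a, h⟫_ℂ = (‖a‖ ^ 2 : ℝ) := by
      rw [sum_inner]
      simp_rw [← hadj]
      rw [← inner_sum, ← inner_starProjection_of_mem haA, ← ha, inner_self_eq_norm_sq_to_K]
      norm_cast
    have h2 := norm_inner_le_norm (𝕜 := ℂ) (∑ n ∈ Finset.range N, ((walk A B)⁻¹ ^ n) a) h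
    rwa [h1, Complex.norm_real, Real.norm_of_nonneg (by positivity)] at h2
  rcases (norm_nonneg a).eq_or_lt with h0 | h0
  · rw [← h0, mul_zero]; exact norm_nonneg _
  · refine le_of_mul_le_mul_right ?_ h0
    calc √δ * ‖a‖ * ‖a‖ = √δ * ‖a‖ ^ 2 := by ring
      _ ≤ √δ * (‖∑ n ∈ Finset.range N, ((walk A B)⁻¹ ^ n) a‖ * ‖h‖) := by gcongr
      _ = √δ * ‖∑ n ∈ Finset.range N, ((walk A B)⁻¹ ^ n) a‖ * ‖h‖ := by ring
      _ ≤ ‖a‖ * ‖h‖ := by gcongr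
      _ = _ := by ring

end TwoProjections

/-! ### The stationary distribution and the fixed vector of the discriminant -/

section ChainFacts

variable {X : Type*} [Fintype X] [DecidableEq X] {P : Matrix X X ℝ} {pi : X → ℝ}

/-- Some x has mass, a power of P leads from x to y by irreducibility, and pi is stationary under
that power too. -/
theorem IsStationaryDistribution.pos (hpi : IsStationaryDistribution P pi)
    (hP : P.IsIrreducible) (y : X) : 0 < pi y := by
  obtain ⟨x, hx⟩ : ∃ x, 0 < pi x := by
    by_contra! h
    have h1 : ∑ x, pi x ≤ 0 := Finset.sum_nonpos fun x _ => h x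
    linarith [hpi.1.2]
  obtain ⟨k, -, hk⟩ := (Matrix.isIrreducible_iff_exists_pow_pos hP.nonneg).1 hP x y
  have hpow : pi ᵥ* (P ^ k) = pi := by
    clear hk
    induction k with
    | zero => simp
    | succ k ih => rw [pow_succ, ← Matrix.vecMul_vecMul, ih, hpi.2]
  have hnn : ∀ z, 0 ≤ (P ^ k) z y := by
    clear hk hpow
    intro z
    induction k generalizing z with
    | zero => rw [pow_zero, Matrix.one_apply]; split_ifs <;> norm_num
    | succ k ih =>
      rw [pow_succ', Matrix.mul_apply]
      exact Finset.sum_nonneg fun w _ => mul_nonneg (hP.nonneg z w) (ih w)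
  rw [← hpow]
  calc 0 < pi x * (P ^ k) x y := mul_pos hx hk
    _ ≤ ∑ z, pi z * (P ^ k) z y := Finset.single_le_sum
        (f := fun z => pi z * (P ^ k) z y)
        (fun z _ => mul_nonneg (hpi.1.1 z) (hnn z)) (Finset.mem_univ x)

theorem discriminant_apply (P : Matrix X X ℝ) (pi : X → ℝ) (x y : X) :
    discriminant P pi x y = √(pi x) * P x y * (√(pi y))⁻¹ := by
  simp [discriminant, Matrix.mul_diagonal, Matrix.diagonal_mul]

theorem discriminant_mulVec_sqrt (hP : P ∈ Matrix.rowStochastic ℝ X) (hpos : ∀ x, 0 < pi x) :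
    discriminant P pi *ᵥ (fun x => √(pi x)) = fun x => √(pi x) := by
  ext x
  simp only [Matrix.mulVec, dotProduct, discriminant_apply]
  have h : ∀ y, √(pi x) * P x y * (√(pi y))⁻¹ * √(pi y) = √(pi x) * P x y := fun y => by
    rw [inv_mul_cancel_right₀ (Real.sqrt_pos.2 (hpos y)).ne']
  simp_rw [h]
  rw [← Finset.mul_sum, Matrix.sum_row_of_mem_rowStochastic hP, mul_one]

theorem discriminant_transpose_mulVec_sqrt (hpi : IsStationaryDistribution P pi)
    (hpos : ∀ x, 0 < pi x) :
    (discriminant P pi)ᵀ *ᵥ (fun x => √(pi x)) = fun x => √(pi x) := by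
  ext y
  simp only [Matrix.mulVec, dotProduct, Matrix.transpose_apply, discriminant_apply]
  have h : ∀ x, √(pi x) * P x y * (√(pi y))⁻¹ * √(pi x) = pi x * P x y * (√(pi y))⁻¹ := by
    intro x
    nth_rewrite 3 [← Real.mul_self_sqrt (hpos x).le]
    ring
  simp_rw [h]
  rw [← Finset.sum_mul, show ∑ x, pi x * P x y = pi y from congrFun hpi.2 y]
  nth_rewrite 1 [← Real.mul_self_sqrt (hpos y).le]
  rw [mul_inv_cancel_right₀ (Real.sqrt_pos.2 (hpos y)).ne']

end ChainFacts

/-! ### From the singular value gap to a bound on the bilinear form of the discriminant -/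

section SingularValues

open scoped InnerProductSpace

/-- Right singular vectors of index at least 1 have singular value below 1, hence are orthogonal to
the vector u fixed by T*T. So u spans the direction of index 0, and v ⊥ u has no component there. -/
theorem norm_apply_le_singularValues_one {E : Type*} [NormedAddCommGroup E]
    [InnerProductSpace ℝ E] [FiniteDimensional ℝ E] (T : E →ₗ[ℝ] E) {u v : E}
    (hu : T.adjoint (T u) = u) (hu0 : u ≠ 0) (h1 : T.singularValues 1 < 1)
    (huv : ⟪u, v⟫_ℝ = 0) : ‖T v‖ ≤ T.singularValues 1 * ‖v‖ := by
  have hT := T.isSymmetric_adjoint_comp_self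
  set b := hT.eigenvectorBasis rfl with hb
  set σ := T.singularValues
  have hσ0 : 0 ≤ σ 1 := T.singularValues_nonneg 1
  have hinner : ∀ i z, ⟪b i, T.adjoint (T z)⟫_ℝ = σ i ^ 2 * ⟪b i, z⟫_ℝ := by
    intro i z
    have h := hT.apply_eigenvectorBasis rfl i
    rw [← hb, ← T.sq_singularValues_fin rfl i] at h
    have h' : ⟪b i, (T.adjoint ∘ₗ T) z⟫_ℝ = ⟪(T.adjoint ∘ₗ T) (b i), z⟫_ℝ := (hT (b i) z).symm
    rw [h, inner_smul_left] at h'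
    exact h'
  have hle : ∀ i : Fin (Module.finrank ℝ E), (i : ℕ) ≠ 0 → σ i ≤ σ 1 := fun i hi =>
    T.singularValues_antitone (Nat.one_le_iff_ne_zero.2 hi)
  have hz : ∀ i : Fin (Module.finrank ℝ E), (i : ℕ) ≠ 0 → ⟪b i, u⟫_ℝ = 0 := by
    intro i hi
    have h := hinner i u
    rw [hu] at h
    have h2 : σ i < 1 := (hle i hi).trans_lt h1
    have h3 : 0 ≤ σ i := T.singularValues_nonneg i
    have h4 : (1 - σ i ^ 2) * ⟪b i, u⟫_ℝ = 0 := by linarith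
    exact (mul_eq_zero.1 h4).resolve_left (by nlinarith)
  have hv : ∀ i : Fin (Module.finrank ℝ E), (i : ℕ) = 0 → ⟪b i, v⟫_ℝ = 0 := by
    intro i hi
    have hother : ∀ j, j ≠ i → ⟪b j, u⟫_ℝ = 0 := fun j hj =>
      hz j fun h => hj (Fin.ext (h.trans hi.symm))
    have hui : u = ⟪b i, u⟫_ℝ • b i := by
      conv_lhs => rw [← b.sum_repr' u]
      rw [Finset.sum_eq_single i (fun j _ hj => by rw [hother j hj, zero_smul]) (by simp)]
    have hne : ⟪b i, u⟫_ℝ ≠ 0 := fun h => hu0 (by rw [hui, h, zero_smul])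
    rw [hui, inner_smul_left] at huv
    exact (mul_eq_zero.1 huv).resolve_left hne
  have hsq : ‖T v‖ ^ 2 = ∑ i : Fin (Module.finrank ℝ E), σ i ^ 2 * ⟪b i, v⟫_ℝ ^ 2 := by
    rw [← real_inner_self_eq_norm_sq, ← T.adjoint_inner_right, ← b.sum_inner_mul_inner]
    refine Finset.sum_congr rfl fun i _ => ?_
    rw [hinner, real_inner_comm]; ring
  have hvsq : ‖v‖ ^ 2 = ∑ i, ⟪b i, v⟫_ℝ ^ 2 := by
    rw [← real_inner_self_eq_norm_sq, ← b.sum_inner_mul_inner]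
    refine Finset.sum_congr rfl fun i _ => ?_
    rw [real_inner_comm]; ring
  refine abs_le_of_sq_le_sq' ?_ (by positivity) |>.2
  rw [mul_pow, hsq, hvsq, Finset.mul_sum]
  refine Finset.sum_le_sum fun i _ => ?_
  by_cases hi : (i : ℕ) = 0
  · rw [hv i hi]; simp
  · have := hle i hi
    have h3 : 0 ≤ σ i := T.singularValues_nonneg i
    gcongr

variable {X : Type*} [Fintype X] [DecidableEq X] {P : Matrix X X ℝ} {pi : X → ℝ} {δ : ℝ}

theorem sum_sq_discriminant_mulVec_le (hP : P ∈ Matrix.rowStochastic ℝ X)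
    (hpi : IsStationaryDistribution P pi) (hpos : ∀ x, 0 < pi x)
    (hgap : singularValueGap (discriminant P pi) = δ) (hδ : 0 < δ) {v : X → ℝ}
    (hv : ∑ x, √(pi x) * v x = 0) :
    ∑ x, (discriminant P pi *ᵥ v) x ^ 2 ≤ (1 - δ) ^ 2 * ∑ x, v x ^ 2 := by
  set T := Matrix.toEuclideanLin (discriminant P pi) with hT
  have hσ : T.singularValues 1 = 1 - δ := by
    rw [← hgap, singularValueGap, singularValue, sub_sub_cancel]
  set u : EuclideanSpace ℝ X := WithLp.toLp 2 fun x => √(pi x) with hu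
  have hTu : T u = u := by
    rw [hT, Matrix.toLpLin_apply, hu, discriminant_mulVec_sqrt hP hpos]
  have hTu' : T.adjoint u = u := by
    rw [hT, ← Matrix.toEuclideanLin_conjTranspose_eq_adjoint, Matrix.toLpLin_apply, hu,
      Matrix.conjTranspose_eq_transpose_of_trivial, discriminant_transpose_mulVec_sqrt hpi hpos]
  have hu0 : u ≠ 0 := by
    intro h
    have h1 : ∑ x, pi x = 1 := hpi.1.2
    have h2 : ∀ x, √(pi x) = 0 := fun x => congrFun (congrArg WithLp.ofLp h) x
    have h3 : ∀ x, pi x = 0 := fun x => absurd (h2 x) (Real.sqrt_pos.2 (hpos x)).ne'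
    simp [h3] at h1
  have h := norm_apply_le_singularValues_one T (u := u) (v := WithLp.toLp 2 v)
    (by rw [hTu, hTu']) hu0 (by rw [hσ]; linarith)
    (by
      rw [PiLp.inner_apply, ← hv]
      exact Finset.sum_congr rfl fun x _ => by simp [hu, mul_comm])
  have h' := pow_le_pow_left₀ (norm_nonneg _) h 2
  rw [mul_pow, hσ, EuclideanSpace.norm_sq_eq, EuclideanSpace.norm_sq_eq] at h'
  simpa [hT, Matrix.toLpLin_apply] using h'

theorem gap_le_one (hgap : singularValueGap (discriminant P pi) = δ) : δ ≤ 1 := by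
  have : 0 ≤ (Matrix.toEuclideanLin (discriminant P pi)).singularValues 1 :=
    LinearMap.singularValues_nonneg _ 1
  rw [singularValueGap, singularValue] at hgap
  linarith

/-- The discriminant is real, so it acts separately on the real and imaginary parts of b, and both
are orthogonal to √π. -/
theorem norm_sum_discriminant_le (hP : P ∈ Matrix.rowStochastic ℝ X)
    (hpi : IsStationaryDistribution P pi) (hpos : ∀ x, 0 < pi x)
    (hgap : singularValueGap (discriminant P pi) = δ) (hδ : 0 < δ) (a b : EuclideanSpace ℂ X)
    (hb : ∑ x, (√(pi x) : ℂ) * b x = 0) :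
    ‖∑ x, ∑ y, star (a x) * (discriminant P pi x y : ℂ) * b y‖ ≤ (1 - δ) * ‖a‖ * ‖b‖ := by
  set D := discriminant P pi
  set c : EuclideanSpace ℂ X := WithLp.toLp 2 fun x => ∑ y, (D x y : ℂ) * b y with hc
  have hre := sum_sq_discriminant_mulVec_le hP hpi hpos hgap hδ (v := fun x => (b x).re)
    (by simpa using congrArg Complex.re hb)
  have him := sum_sq_discriminant_mulVec_le hP hpi hpos hgap hδ (v := fun x => (b x).im)
    (by simpa using congrArg Complex.im hb)
  have hcb : ‖c‖ ≤ (1 - δ) * ‖b‖ := by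
    refine abs_le_of_sq_le_sq' ?_
      (mul_nonneg (by linarith [gap_le_one hgap]) (norm_nonneg b)) |>.2
    rw [mul_pow, EuclideanSpace.norm_sq_eq, EuclideanSpace.norm_sq_eq]
    have h1 : ∀ z : ℂ, ‖z‖ ^ 2 = z.re ^ 2 + z.im ^ 2 := fun z => by
      rw [Complex.sq_norm, Complex.normSq_apply]; ring
    have h2 : ∀ x, ‖c x‖ ^ 2 = (D *ᵥ fun x => (b x).re) x ^ 2 + (D *ᵥ fun x => (b x).im) x ^ 2 := by
      intro x
      rw [h1]
      simp [hc, Matrix.mulVec, dotProduct]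
    simp_rw [h2, h1, Finset.sum_add_distrib, mul_add]
    exact add_le_add hre him
  have hinner : ∑ x, ∑ y, star (a x) * (D x y : ℂ) * b y = ⟪a, c⟫_ℂ := by
    rw [PiLp.inner_apply]
    refine Finset.sum_congr rfl fun x _ => ?_
    simp only [hc, RCLike.inner_apply, mul_assoc, ← Finset.mul_sum]
    rw [mul_comm]; rfl
  rw [hinner]
  calc _ ≤ ‖a‖ * ‖c‖ := norm_inner_le_norm _ _
    _ ≤ ‖a‖ * ((1 - δ) * ‖b‖) := by gcongr
    _ = _ := by ring

end SingularValues

/-! ### Amplitude amplification with an imperfect reflection and unknown amplitude -/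

section Amplification

open scoped InnerProductSpace

variable {E : Type*} [NormedAddCommGroup E] [InnerProductSpace ℂ E] {G : E →ₗ[ℂ] E} {p : E}

theorem inner_apply_self_of_symmetric (hG : G.IsSymmetric) (hGG : ∀ u, G (G u) = G u) (u : E) :
    ⟪u, G u⟫_ℂ = (‖G u‖ ^ 2 : ℝ) := by
  rw [← hGG u, ← hG u (G u), inner_self_eq_norm_sq_to_K, hGG]
  norm_cast

theorem norm_apply_le_of_symmetric (hG : G.IsSymmetric) (hGG : ∀ u, G (G u) = G u) (u : E) :
    ‖G u‖ ≤ ‖u‖ := by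
  have h := norm_inner_le_norm (𝕜 := ℂ) u (G u)
  rw [inner_apply_self_of_symmetric hG hGG, Complex.norm_real,
    Real.norm_of_nonneg (by positivity), sq] at h
  rcases (norm_nonneg (G u)).eq_or_lt with h0 | h0
  · rw [← h0]; exact norm_nonneg u
  · exact le_of_mul_le_mul_right h h0

/-- Write U⁻¹GUp = s²p + q' with q' ⊥ p. The phase flip and U⁻¹ lead to (1-2s²)p - 2q'; reflecting
exactly in p and applying U and G would give (4s²-3)GUp. Only the action of R on q' is inexact, and
‖q'‖ ≤ s makes the error relative to s. The hypothesis on R concerns this single vector, since the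
approximate reflection is controlled only for states with an empty clock. -/
theorem norm_amplification_sub_le (hG : G.IsSymmetric) (hGG : ∀ u, G (G u) = G u)
    (hp : ‖p‖ = 1) (U R : E ≃ₗᵢ[ℂ] E) {β : ℝ} (hβ : 0 ≤ β) (hRp : R p = -p)
    (hR : ∀ q, ⟪p, q⟫_ℂ = 0 → q = U⁻¹ (G (U p)) - (‖G (U p)‖ ^ 2 : ℂ) • p →
      ‖R q - q‖ ≤ β * ‖q‖) :
    ‖G (U (R (U⁻¹ (U p - (2 : ℂ) • G (U p))))) - (4 * ‖G (U p)‖ ^ 2 - 3 : ℂ) • G (U p)‖ ≤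
      2 * β * ‖G (U p)‖ := by
  set g := G (U p) with hg
  set s := ‖g‖ with hs
  set q := U⁻¹ g with hq
  set q' := q - (s ^ 2 : ℂ) • p with hq'
  have hUq : U q = g := U.apply_symm_apply g
  have hUp : U⁻¹ (U p) = p := U.symm_apply_apply p
  have hpp : ⟪p, p⟫_ℂ = 1 := by rw [inner_self_eq_norm_sq_to_K, hp]; simp
  have hpq : ⟪p, q⟫_ℂ = (s ^ 2 : ℂ) := by
    rw [← U.inner_map_map p q, hUq, hg, inner_apply_self_of_symmetric hG hGG]
    push_cast; rfl
  have hpq' : ⟪p, q'⟫_ℂ = 0 := by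
    rw [hq', inner_sub_right, inner_smul_right, hpq, hpp, mul_one, sub_self]
  have hqn : ‖q‖ = s := by rw [hq, LinearIsometryEquiv.norm_map]
  have hq'n : ‖q'‖ ≤ s := by
    refine abs_le_of_sq_le_sq' ?_ (norm_nonneg g) |>.2
    have h : ‖q‖ ^ 2 = ‖q'‖ ^ 2 + ‖(s ^ 2 : ℂ) • p‖ ^ 2 := by
      have : q = q' + (s ^ 2 : ℂ) • p := by rw [hq']; abel
      rw [this, @norm_add_sq ℂ, inner_smul_right, ← inner_conj_symm, hpq']
      simp
    rw [hqn] at h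
    nlinarith [sq_nonneg ‖(s ^ 2 : ℂ) • p‖]
  have herr := (hR q' hpq' hq').trans (mul_le_mul_of_nonneg_left hq'n hβ)
  have h1 : U⁻¹ (U p - (2 : ℂ) • g) = (1 - 2 * s ^ 2 : ℂ) • p - (2 : ℂ) • q' := by
    rw [map_sub, map_smul, hUp, ← hq, hq']
    module
  have hUq' : U q' = g - (s ^ 2 : ℂ) • U p := by rw [hq', map_sub, map_smul, hUq]
  have h2 : U (R (U⁻¹ (U p - (2 : ℂ) • g))) =
      (4 * s ^ 2 - 1 : ℂ) • U p - (2 : ℂ) • g - (2 : ℂ) • U (R q' - q') := by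
    have h : R ((1 - 2 * s ^ 2 : ℂ) • p - (2 : ℂ) • q') =
        (2 * s ^ 2 - 1 : ℂ) • p - (2 : ℂ) • q' - (2 : ℂ) • (R q' - q') := by
      rw [map_sub, map_smul, map_smul, hRp]
      module
    rw [h1, h, map_sub, map_sub, map_smul, map_smul, map_smul, hUq']
    module
  have h3 : G (U (R (U⁻¹ (U p - (2 : ℂ) • g)))) - (4 * s ^ 2 - 3 : ℂ) • g =
      -((2 : ℂ) • G (U (R q' - q'))) := by
    rw [h2, map_sub, map_sub, map_smul, map_smul, map_smul, hg, hGG, ← hg]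
    module
  rw [h3, norm_neg, norm_smul]
  calc _ = 2 * ‖G (U (R q' - q'))‖ := by simp
    _ ≤ 2 * ‖R q' - q'‖ := by
        gcongr
        exact (norm_apply_le_of_symmetric hG hGG _).trans (U.norm_map _).le
    _ ≤ 2 * (β * s) := by gcongr
    _ = _ := by ring

/-- As long as s ≤ 1/4, the quantity s + s³ grows by a factor 3 - 2^-(i+2) or more per level: the
gain of the cubic term outweighs the loss 4s³. These factors multiply to at least 3^i/2, so s cannot
stay small at all even levels up to 2L. Take the first even level above 1/16; below it each level at
least doubles s. -/
theorem exists_level_of_growth {s : ℕ → ℝ} {L : ℕ} (hs : ∀ i, 0 ≤ s i)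
    (hlow : ∀ i < 2 * L, (3 - 4 * s i ^ 2 - (1 / 2) ^ (i + 2)) * s i ≤ s (i + 1))
    (hup : ∀ i < 2 * L, s (i + 1) ≤ (3 + (1 / 2) ^ (i + 2)) * s i)
    (hinit : 1 ≤ 9 ^ L * s 0) :
    ∃ l ≤ L, 1 / 16 < s (2 * l) ∧ ∀ l' < l, 4 * s (2 * l') ≤ s (2 * (l' + 1)) := by
  have hβ : ∀ i : ℕ, ((1 : ℝ) / 2) ^ (i + 2) ≤ 1 / 4 := fun i => by
    rw [pow_add]
    have : ((1 : ℝ) / 2) ^ i ≤ 1 := pow_le_one₀ (by norm_num) (by norm_num)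
    nlinarith
  have hodd : ∀ l < L, s (2 * l) ≤ 1 / 16 → s (2 * l + 1) ≤ 1 / 4 := fun l hl h => by
    have h1 := hup (2 * l) (by omega)
    have h2 := hβ (2 * l)
    nlinarith [hs (2 * l)]
  have hex : ∃ l, l ≤ L ∧ 1 / 16 < s (2 * l) := by
    by_contra! hcon
    have hq : ∀ i < 2 * L, s i ≤ 1 / 4 := by
      intro i hi
      rcases Nat.even_or_odd' i with ⟨l, rfl | rfl⟩
      · linarith [hcon l (by omega)]
      · exact hodd l (by omega) (hcon l (by omega))
    -- The bracket falls from 1 towards 1/2, and its decrease pays for the relative errors of the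
    -- levels.
    have hy : ∀ i ≤ 2 * L, 3 ^ i * s 0 * (1 / 2 + (1 / 2) ^ (i + 1)) ≤ s i + s i ^ 3 := by
      intro i
      induction i with
      | zero =>
        intro _
        have := hs 0
        have h3 : 0 ≤ s 0 ^ 3 := by positivity
        norm_num; linarith
      | succ i ih =>
        intro hi
        have h0 := ih (by omega)
        have h1 := hlow i (by omega)
        have h2 := hq i (by omega)
        have h3 := hβ i
        have h4 := hs i
        have hb : (0 : ℝ) ≤ (1 / 2) ^ i := by positivity
        set b : ℝ := (1 / 2) ^ i with hbdef
        have e1 : ((1 : ℝ) / 2) ^ (i + 2) = b / 4 := by rw [hbdef, pow_add]; ring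
        have e2 : ((1 : ℝ) / 2) ^ (i + 1) = b / 2 := by rw [hbdef, pow_add]; ring
        have e3 : ((1 : ℝ) / 2) ^ (i + 1 + 1) = b / 4 := by rw [hbdef, pow_add, pow_add]; ring
        rw [e1] at h1 h3
        rw [e2] at h0
        rw [e3]
        set t := s i with ht
        have h5 : 5 / 2 * t ≤ s (i + 1) := by
          refine le_trans ?_ h1
          gcongr
          nlinarith
        -- (5/2)³ > 15, and after the loss of 4t³ in h1 a coefficient 11 remains, where 3 is enough.
        have h6 : 15 * t ^ 3 ≤ s (i + 1) ^ 3 := by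
          calc 15 * t ^ 3 ≤ (5 / 2 * t) ^ 3 := by rw [mul_pow]; nlinarith [pow_nonneg h4 3]
            _ ≤ _ := by gcongr
        have h7 : (3 - b / 4) * (t + t ^ 3) ≤ s (i + 1) + s (i + 1) ^ 3 := by
          nlinarith [pow_nonneg h4 3, mul_nonneg hb (pow_nonneg h4 3)]
        have hz : 0 ≤ 3 ^ i * s 0 := mul_nonneg (by positivity) (hs 0)
        calc 3 ^ (i + 1) * s 0 * (1 / 2 + b / 4) = 3 ^ i * s 0 * (3 * (1 / 2 + b / 4)) := by ring
          _ ≤ 3 ^ i * s 0 * ((3 - b / 4) * (1 / 2 + b / 2)) := by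
              refine mul_le_mul_of_nonneg_left ?_ hz
              nlinarith
          _ = (3 - b / 4) * (3 ^ i * s 0 * (1 / 2 + b / 2)) := by ring
          _ ≤ (3 - b / 4) * (t + t ^ 3) := by
              refine mul_le_mul_of_nonneg_left h0 (by linarith)
          _ ≤ _ := h7
    -- The left side is now more than 1/2, the right side at most 1/16 + 1/16³.
    have h1 := hy (2 * L) le_rfl
    have h2 := hcon L le_rfl
    have h3 : s (2 * L) ^ 3 ≤ (1 / 16) ^ 3 := pow_le_pow_left₀ (hs _) h2 3
    rw [pow_mul] at h1
    norm_num at h1 h3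
    have h4 : (0 : ℝ) ≤ (1 / 2) ^ (2 * L + 1) := by positivity
    nlinarith
  classical
  refine ⟨Nat.find hex, (Nat.find_spec hex).1, (Nat.find_spec hex).2, fun l hl => ?_⟩
  have hlL : l < L := hl.trans_le (Nat.find_spec hex).1
  have h1 : s (2 * l) ≤ 1 / 16 := by
    by_contra! h
    exact Nat.find_min hex hl ⟨hlL.le, h⟩
  have h2 := hodd l hlL h1
  have h3 := hlow (2 * l) (by omega)
  have h4 := hlow (2 * l + 1) (by omega)
  have h5 := hβ (2 * l)
  have h6 := hβ (2 * l + 1)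
  have h7 := hs (2 * l)
  have h8 := hs (2 * l + 1)
  have h9 : 2 * s (2 * l) ≤ s (2 * l + 1) := by
    refine le_trans ?_ h3
    gcongr; nlinarith
  have h10 : 2 * s (2 * l + 1) ≤ s (2 * l + 1 + 1) := by
    refine le_trans ?_ h4
    gcongr; nlinarith
  rw [show 2 * (l + 1) = 2 * l + 1 + 1 by ring]
  linarith

/-- Stopping at the marked vectors after each second level finds a marked vector with constant
amplitude, whatever the initial amplitude is. -/
theorem exists_norm_marked_ge (hG : G.IsSymmetric) (hGG : ∀ u, G (G u) = G u)
    (U : ℕ → E ≃ₗᵢ[ℂ] E) {L : ℕ}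
    (hstep : ∀ i < 2 * L,
      ‖G (U (i + 1) p) - (4 * ‖G (U i p)‖ ^ 2 - 3 : ℂ) • G (U i p)‖ ≤
        (1 / 2) ^ (i + 2) * ‖G (U i p)‖)
    (hp : ‖p‖ = 1) (hinit : 1 ≤ 9 ^ L * ‖G (U 0 p)‖) {v : ℕ → E} (hv0 : v 0 = p)
    (hv : ∀ l, v (l + 1) = v l - (U (2 * l))⁻¹ (G (U (2 * l) (v l)))) :
    ∃ l ≤ L, 1 / 32 ≤ ‖G (U (2 * l) (v l))‖ := by
  have hle1 : ∀ i, ‖G (U i p)‖ ≤ 1 := fun i =>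
    (norm_apply_le_of_symmetric hG hGG _).trans (by rw [LinearIsometryEquiv.norm_map, hp])
  have hnorm : ∀ i, ‖(4 * ‖G (U i p)‖ ^ 2 - 3 : ℂ) • G (U i p)‖ =
      |4 * ‖G (U i p)‖ ^ 2 - 3| * ‖G (U i p)‖ := fun i => by
    rw [norm_smul, ← Real.norm_eq_abs, ← Complex.norm_real]
    push_cast; rfl
  obtain ⟨l, hl, hl1, hgrow⟩ := exists_level_of_growth (s := fun i => ‖G (U i p)‖) (L := L)
    (fun i => norm_nonneg _)
    (fun i hi => by
      have h1 := hstep i hi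
      have h2 := norm_sub_norm_le ((4 * ‖G (U i p)‖ ^ 2 - 3 : ℂ) • G (U i p)) (G (U (i + 1) p))
      rw [norm_sub_rev, hnorm] at h2
      have h3 : (3 - 4 * ‖G (U i p)‖ ^ 2) * ‖G (U i p)‖ ≤
          |4 * ‖G (U i p)‖ ^ 2 - 3| * ‖G (U i p)‖ := by
        gcongr
        linarith [neg_abs_le (4 * ‖G (U i p)‖ ^ 2 - 3)]
      linarith)
    (fun i hi => by
      have h1 := hstep i hi
      have h2 := norm_sub_norm_le (G (U (i + 1) p)) ((4 * ‖G (U i p)‖ ^ 2 - 3 : ℂ) • G (U i p))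
      rw [hnorm] at h2
      have h3 : |4 * ‖G (U i p)‖ ^ 2 - 3| * ‖G (U i p)‖ ≤ 3 * ‖G (U i p)‖ := by
        gcongr
        have := hle1 i
        rw [abs_le]
        constructor <;> nlinarith [norm_nonneg (G (U i p))]
      linarith)
    hinit
  have hle : ∀ l u, ‖G (U (2 * l) u)‖ ≤ ‖u‖ := fun l u =>
    (norm_apply_le_of_symmetric hG hGG _).trans (LinearIsometryEquiv.norm_map _ _).le
  -- A stage at most doubles the deviation from p and adds the current amplitude. The total is at
  -- most twice that amplitude, hence half the next one by the growth factor 4.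
  have hclose : ∀ l' ≤ l, ‖v l' - p‖ ≤ ‖G (U (2 * l') p)‖ / 2 := by
    intro l'
    induction l' with
    | zero => intro _; rw [hv0, sub_self, norm_zero]; positivity
    | succ l' ih =>
      intro h
      have h1 := ih (by omega)
      have h2 := hgrow l' (by omega)
      have h3 : ‖G (U (2 * l') (v l'))‖ ≤ ‖G (U (2 * l') p)‖ + ‖v l' - p‖ := by
        calc _ = ‖G (U (2 * l') p) + G (U (2 * l') (v l' - p))‖ := by
              rw [← map_add, ← map_add, add_sub_cancel]
          _ ≤ _ := (norm_add_le _ _).trans (by gcongr; exact hle _ _)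
      rw [hv, show v l' - (U (2 * l'))⁻¹ (G (U (2 * l') (v l'))) - p =
        (v l' - p) - (U (2 * l'))⁻¹ (G (U (2 * l') (v l'))) by abel]
      have h4 := norm_sub_le (v l' - p) ((U (2 * l'))⁻¹ (G (U (2 * l') (v l'))))
      rw [LinearIsometryEquiv.norm_map] at h4
      linarith
  refine ⟨l, hl, ?_⟩
  have h1 := hclose l le_rfl
  have h2 : ‖G (U (2 * l) p)‖ ≤ ‖G (U (2 * l) (v l))‖ + ‖v l - p‖ := by
    calc _ = ‖G (U (2 * l) (v l)) - G (U (2 * l) (v l - p))‖ := by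
          rw [← map_sub, ← map_sub, sub_sub_cancel]
      _ ≤ _ := (norm_sub_le _ _).trans (by gcongr; exact hle _ _)
  linarith

end Amplification

noncomputable section

/-! ### Unitary matrices as isometries -/

section Unitaries

/-- The isometry of Euclidean space that a unitary matrix describes. -/
def unitaryIso {n : Type*} [Fintype n] [DecidableEq n] :
    Matrix.unitaryGroup n ℂ →* (EuclideanSpace ℂ n ≃ₗᵢ[ℂ] EuclideanSpace ℂ n) :=
  (Unitary.linearIsometryEquiv (𝕜 := ℂ) (H := EuclideanSpace ℂ n)).toMonoidHom.comp
    (Unitary.map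
      { toFun := Matrix.toEuclideanCLM (n := n) (𝕜 := ℂ)
        map_one' := map_one _
        map_mul' := map_mul _
        map_star' := map_star _ }).toMonoidHom

theorem ofLp_unitaryIso {n : Type*} [Fintype n] [DecidableEq n] (Q : Matrix.unitaryGroup n ℂ)
    (ψ : EuclideanSpace ℂ n) : (unitaryIso Q ψ).ofLp = Q.1 *ᵥ ψ.ofLp := rfl

theorem diagonal_sign_mem_unitaryGroup {n : Type*} [Fintype n] [DecidableEq n] (p : n → Prop)
    [DecidablePred p] :
    Matrix.diagonal (fun k => if p k then (-1 : ℂ) else 1) ∈ Matrix.unitaryGroup n ℂ := by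
  rw [Matrix.mem_unitaryGroup_iff, Matrix.star_eq_conjTranspose, Matrix.diagonal_conjTranspose,
    Matrix.diagonal_mul_diagonal, ← Matrix.diagonal_one]
  congr 1
  ext k
  by_cases h : p k <;> simp [h]

theorem controlled_mem_unitaryGroup {B K : Type*} [Fintype B] [DecidableEq B] [Fintype K]
    [DecidableEq K] (p : B → Prop) [DecidablePred p] (V : Matrix.unitaryGroup K ℂ) :
    controlled p V.1 ∈ Matrix.unitaryGroup (B × K) ℂ := by
  have hV : V.1 * V.1ᴴ = 1 := Matrix.mem_unitaryGroup_iff.1 V.2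
  have hz : (fun b : B => (if p b then (1 : ℂ) else 0) * (if p b then 0 else 1)) = 0 := by
    ext b; by_cases h : p b <;> simp [h]
  have hz' : (fun b : B => (if p b then (0 : ℂ) else 1) * (if p b then 1 else 0)) = 0 := by
    ext b; by_cases h : p b <;> simp [h]
  have h1 : star (fun b : B => if p b then (1 : ℂ) else 0) = fun b => if p b then 1 else 0 := by
    ext b; by_cases h : p b <;> simp [h]
  have h0 : star (fun b : B => if p b then (0 : ℂ) else 1) = fun b => if p b then 0 else 1 := by
    ext b; by_cases h : p b <;> simp [h]
  rw [Matrix.mem_unitaryGroup_iff, Matrix.star_eq_conjTranspose, controlled,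
    Matrix.conjTranspose_add, Matrix.conjTranspose_kronecker, Matrix.conjTranspose_kronecker,
    Matrix.diagonal_conjTranspose, Matrix.diagonal_conjTranspose, h1, h0, add_mul, mul_add,
    mul_add, ← Matrix.mul_kronecker_mul, ← Matrix.mul_kronecker_mul, ← Matrix.mul_kronecker_mul,
    ← Matrix.mul_kronecker_mul, Matrix.diagonal_mul_diagonal, Matrix.diagonal_mul_diagonal,
    Matrix.diagonal_mul_diagonal, Matrix.diagonal_mul_diagonal, hz, hz', hV,
    Matrix.conjTranspose_one, mul_one (1 : Matrix K K ℂ)]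
  have hd : Matrix.diagonal (0 : B → ℂ) = 0 := Matrix.diagonal_zero
  rw [hd, Matrix.zero_kronecker, Matrix.zero_kronecker, add_zero, zero_add,
    ← Matrix.add_kronecker, Matrix.diagonal_add]
  have h2 : (fun b : B => (if p b then (1 : ℂ) else 0) * (if p b then 1 else 0) +
      (if p b then 0 else 1) * (if p b then 0 else 1)) = fun _ => 1 := by
    ext b; by_cases h : p b <;> simp [h]
  rw [h2, Matrix.diagonal_one, Matrix.one_kronecker_one]

end Unitaries

/-! ### Circuits as isometries -/

section Circuits

variable {X D : Type*} [Fintype X] [DecidableEq X] {K : Type} [Fintype K] [DecidableEq K]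
  {d : X → D} {zero : X} {P : Matrix X X ℝ} {pi : X → ℝ}

theorem Instr.op_mem_unitaryGroup (O : UpdateOracle d zero P pi) (M : Finset X) (g : Instr K) :
    g.op O M ∈ Matrix.unitaryGroup (Edge d × K) ℂ := by
  cases g with
  | work V => exact Matrix.kronecker_mem_unitary (one_mem _) V.2
  | ifZeroFst V => exact controlled_mem_unitaryGroup _ V
  | ifZeroSnd V => exact controlled_mem_unitaryGroup _ V
  | updateRight => exact Matrix.kronecker_mem_unitary O.right.2 (one_mem _)
  | updateRightInv => exact Matrix.kronecker_mem_unitary (O.right⁻¹).2 (one_mem _)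
  | updateLeft => exact Matrix.kronecker_mem_unitary O.left.2 (one_mem _)
  | updateLeftInv => exact Matrix.kronecker_mem_unitary (O.left⁻¹).2 (one_mem _)
  | check T => exact diagonal_sign_mem_unitaryGroup fun s : Edge d × K => s.1.1.state ∈ M ∧ s.2 ∈ T

/-- The isometry that an instruction performs. -/
def gateIso (O : UpdateOracle d zero P pi) (M : Finset X) (g : Instr K) :
    EuclideanSpace ℂ (Edge d × K) ≃ₗᵢ[ℂ] EuclideanSpace ℂ (Edge d × K) :=
  unitaryIso ⟨g.op O M, g.op_mem_unitaryGroup O M⟩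

theorem ofLp_gateIso (O : UpdateOracle d zero P pi) (M : Finset X) (g : Instr K)
    (ψ : EuclideanSpace ℂ (Edge d × K)) : (gateIso O M g ψ).ofLp = g.op O M *ᵥ ψ.ofLp := rfl

/-- The isometry that a list of instructions performs. -/
def circuitIso (O : UpdateOracle d zero P pi) (M : Finset X) :
    List (Instr K) → (EuclideanSpace ℂ (Edge d × K) ≃ₗᵢ[ℂ] EuclideanSpace ℂ (Edge d × K))
  | [] => 1
  | g :: c => circuitIso O M c * gateIso O M g

variable {O : UpdateOracle d zero P pi} {M : Finset X}

theorem circuitIso_append (c c' : List (Instr K)) :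
    circuitIso O M (c ++ c') = circuitIso O M c' * circuitIso O M c := by
  induction c with
  | nil => exact (mul_one _).symm
  | cons g c ih => rw [List.cons_append, circuitIso, ih, circuitIso, mul_assoc]

theorem circuitIso_append_apply (c c' : List (Instr K)) (ψ : EuclideanSpace ℂ (Edge d × K)) :
    circuitIso O M (c ++ c') ψ = circuitIso O M c' (circuitIso O M c ψ) := by
  rw [circuitIso_append]; rfl

theorem ofLp_circuitIso (c : List (Instr K)) (ψ : EuclideanSpace ℂ (Edge d × K)) :
    (circuitIso O M c ψ).ofLp = c.foldl (fun φ g => g.op O M *ᵥ φ) ψ.ofLp := by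
  induction c generalizing ψ with
  | nil => rfl
  | cons g c ih =>
    rw [List.foldl_cons, ← ofLp_gateIso, ← ih]; rfl

end Circuits

/-! ### Components of a state along the workspace basis -/

section Slices

variable {ι K : Type*}

/-- The component of a state at the workspace state `k`. -/
def slice (k : K) : EuclideanSpace ℂ (ι × K) →ₗ[ℂ] EuclideanSpace ℂ ι where
  toFun ψ := WithLp.toLp 2 fun e => ψ (e, k)
  map_add' _ _ := rfl
  map_smul' _ _ := rfl

theorem slice_apply (k : K) (ψ : EuclideanSpace ℂ (ι × K)) (e : ι) : slice k ψ e = ψ (e, k) := rfl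

theorem ext_slice {ψ φ : EuclideanSpace ℂ (ι × K)} (h : ∀ k, slice k ψ = slice k φ) : ψ = φ := by
  ext ⟨e, k⟩
  rw [← slice_apply, h, slice_apply]

theorem norm_sq_eq_sum_slice [Fintype ι] [Fintype K] (ψ : EuclideanSpace ℂ (ι × K)) :
    ‖ψ‖ ^ 2 = ∑ k, ‖slice k ψ‖ ^ 2 := by
  simp_rw [EuclideanSpace.norm_sq_eq, slice_apply]
  exact Fintype.sum_prod_type_right _

theorem inner_eq_sum_slice [Fintype ι] [Fintype K] (ψ φ : EuclideanSpace ℂ (ι × K)) :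
    inner ℂ ψ φ = ∑ k, inner ℂ (slice k ψ) (slice k φ) := by
  simp_rw [PiLp.inner_apply, slice_apply]
  exact Fintype.sum_prod_type_right _

theorem norm_slice_le [Fintype ι] [Fintype K] (k : K) (ψ : EuclideanSpace ℂ (ι × K)) :
    ‖slice k ψ‖ ≤ ‖ψ‖ := by
  refine abs_le_of_sq_le_sq' ?_ (norm_nonneg ψ) |>.2
  rw [norm_sq_eq_sum_slice ψ]
  exact Finset.single_le_sum (f := fun k => ‖slice k ψ‖ ^ 2) (fun _ _ => by positivity)
    (Finset.mem_univ k)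

/-- The state `h ⊗ |k⟩`. -/
def embed [DecidableEq K] (k : K) : EuclideanSpace ℂ ι →ₗ[ℂ] EuclideanSpace ℂ (ι × K) where
  toFun h := WithLp.toLp 2 fun s => if s.2 = k then h s.1 else 0
  map_add' f g := by
    ext s
    by_cases h : s.2 = k <;> simp [h]
  map_smul' c f := by
    ext s
    by_cases h : s.2 = k <;> simp [h]

theorem slice_embed [DecidableEq K] (k k' : K) (h : EuclideanSpace ℂ ι) :
    slice k' (embed k h) = if k' = k then h else 0 := by
  ext e
  rw [slice_apply]
  by_cases hk : k' = k <;> simp [embed, hk]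

theorem slice_embed_self [DecidableEq K] (k : K) (h : EuclideanSpace ℂ ι) :
    slice k (embed k h) = h := by
  rw [slice_embed, if_pos rfl]

theorem slice_embed_of_ne [DecidableEq K] {k k' : K} (hk : k' ≠ k) (h : EuclideanSpace ℂ ι) :
    slice k' (embed k h) = 0 := by
  rw [slice_embed, if_neg hk]

theorem norm_embed [Fintype ι] [Fintype K] [DecidableEq K] (k : K) (h : EuclideanSpace ℂ ι) :
    ‖embed k h‖ = ‖h‖ := by
  have h1 : ‖embed k h‖ ^ 2 = ‖h‖ ^ 2 := by
    rw [norm_sq_eq_sum_slice, Finset.sum_eq_single k]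
    · rw [slice_embed_self]
    · intro k' _ hk; rw [slice_embed_of_ne hk]; simp
    · simp
  exact (sq_eq_sq₀ (norm_nonneg _) (norm_nonneg _)).1 h1

theorem inner_embed_left [Fintype ι] [Fintype K] [DecidableEq K] (k : K) (h : EuclideanSpace ℂ ι)
    (ψ : EuclideanSpace ℂ (ι × K)) : inner ℂ (embed k h) ψ = inner ℂ h (slice k ψ) := by
  rw [inner_eq_sum_slice, Finset.sum_eq_single k]
  · rw [slice_embed_self]
  · intro k' _ hk; rw [slice_embed_of_ne hk, inner_zero_left]
  · simp

/-- An isometry is trivial on `Z` if it changes no component at a workspace state in `Z`. -/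
def IsTrivialOn [Fintype ι] [Fintype K] (Z : Set K)
    (U : EuclideanSpace ℂ (ι × K) ≃ₗᵢ[ℂ] EuclideanSpace ℂ (ι × K)) : Prop :=
  ∀ ψ, ∀ k ∈ Z, slice k (U ψ) = slice k ψ

variable [Fintype ι] [Fintype K] {Z : Set K}
  {U V : EuclideanSpace ℂ (ι × K) ≃ₗᵢ[ℂ] EuclideanSpace ℂ (ι × K)}

theorem IsTrivialOn.one : IsTrivialOn Z
    (1 : EuclideanSpace ℂ (ι × K) ≃ₗᵢ[ℂ] EuclideanSpace ℂ (ι × K)) := fun _ _ _ => rfl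

theorem IsTrivialOn.mul (hU : IsTrivialOn Z U) (hV : IsTrivialOn Z V) : IsTrivialOn Z (U * V) :=
  fun ψ k hk => (hU (V ψ) k hk).trans (hV ψ k hk)

theorem IsTrivialOn.inv (hU : IsTrivialOn Z U) : IsTrivialOn Z U⁻¹ := fun ψ k hk => by
  rw [← hU (U⁻¹ ψ) k hk]
  exact congrArg (slice k) (U.apply_symm_apply ψ)

/-- The components in Z are preserved and already carry the whole norm, so an isometry leaves
nothing for the others. -/
theorem IsTrivialOn.apply_eq_self (hU : IsTrivialOn Z U) {ψ : EuclideanSpace ℂ (ι × K)}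
    (hψ : ∀ k ∉ Z, slice k ψ = 0) : U ψ = ψ := by
  have h1 : ∑ k, ‖slice k (U ψ)‖ ^ 2 = ∑ k, ‖slice k ψ‖ ^ 2 := by
    rw [← norm_sq_eq_sum_slice, ← norm_sq_eq_sum_slice, LinearIsometryEquiv.norm_map]
  have hle : ∀ k ∈ Finset.univ, ‖slice k ψ‖ ^ 2 ≤ ‖slice k (U ψ)‖ ^ 2 := by
    intro k _
    by_cases hk : k ∈ Z
    · rw [hU ψ k hk]
    · rw [hψ k hk]; simp
  refine ext_slice fun k => ?_
  by_cases hk : k ∈ Z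
  · exact hU ψ k hk
  · have h2 := (Finset.sum_eq_sum_iff_of_le hle).1 h1.symm k (Finset.mem_univ k)
    rw [hψ k hk] at h2 ⊢
    simpa using h2.symm

end Slices

/-! ### The Householder unitary that prepares a uniform superposition -/

section Mixer

variable {K : Type} [Fintype K] [DecidableEq K]

/-- The amplitude `1 / √n` of a uniform superposition over `R ∪ {k₀}`. -/
def uniformAmplitude (k₀ : K) (R : Finset K) : ℂ := ((√((insert k₀ R).card : ℝ))⁻¹ : ℝ)

/-- The difference of `|k₀⟩` and the uniform superposition over `R ∪ {k₀}`. -/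
def mixerVec (k₀ : K) (R : Finset K) (k : K) : ℂ :=
  (if k = k₀ then 1 else 0) - (if k ∈ insert k₀ R then uniformAmplitude k₀ R else 0)

theorem uniformAmplitude_sq (k₀ : K) (R : Finset K) :
    uniformAmplitude k₀ R ^ 2 * (insert k₀ R).card = 1 := by
  have h : (0 : ℝ) < (insert k₀ R).card := by
    exact_mod_cast Finset.card_pos.2 (Finset.insert_nonempty k₀ R)
  rw [uniformAmplitude]
  have : (√((insert k₀ R).card : ℝ))⁻¹ ^ 2 * (insert k₀ R).card = 1 := by
    rw [inv_pow, Real.sq_sqrt h.le, inv_mul_cancel₀ h.ne']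
  exact_mod_cast this

theorem sum_mixerVec_smul {V : Type*} [AddCommGroup V] [Module ℂ V] (k₀ : K) (R : Finset K)
    (f : K → V) : ∑ k, mixerVec k₀ R k • f k =
      f k₀ - uniformAmplitude k₀ R • ∑ k ∈ insert k₀ R, f k := by
  simp only [mixerVec, sub_smul, Finset.sum_sub_distrib, ite_smul, one_smul, zero_smul,
    Finset.sum_ite_eq', Finset.mem_univ, if_true, Finset.sum_ite_mem, Finset.univ_inter,
    Finset.smul_sum]

theorem mixerVec_self (k₀ : K) (R : Finset K) :
    mixerVec k₀ R k₀ = 1 - uniformAmplitude k₀ R := by simp [mixerVec]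

theorem mixerVec_of_mem {k₀ k : K} {R : Finset K} (hk : k ∈ R) (h : k ≠ k₀) :
    mixerVec k₀ R k = -uniformAmplitude k₀ R := by simp [mixerVec, hk, h]

theorem mixerVec_of_notMem {k₀ k : K} {R : Finset K} (hk : k ∉ insert k₀ R) :
    mixerVec k₀ R k = 0 := by
  have : k ≠ k₀ := fun h => hk (h ▸ Finset.mem_insert_self _ _)
  simp only [mixerVec, hk, this, if_false, sub_zero]

/-- This squared length explains the coefficient (1 - s)⁻¹ of the Householder matrix, where s is the
uniform amplitude. -/
theorem sum_mixerVec_mul_self (k₀ : K) (R : Finset K) :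
    ∑ k, mixerVec k₀ R k * mixerVec k₀ R k = 2 * (1 - uniformAmplitude k₀ R) := by
  have h := sum_mixerVec_smul k₀ R (mixerVec k₀ R)
  simp only [smul_eq_mul] at h
  rw [h, mixerVec_self]
  have h2 : ∑ k ∈ insert k₀ R, mixerVec k₀ R k =
      1 - (insert k₀ R).card * uniformAmplitude k₀ R := by
    rw [Finset.sum_congr rfl (g := fun k => (if k = k₀ then 1 else 0) - uniformAmplitude k₀ R)
      (fun k hk => by rw [mixerVec, if_pos hk]), Finset.sum_sub_distrib, Finset.sum_const,
      Finset.sum_ite_eq', if_pos (Finset.mem_insert_self _ _), nsmul_eq_mul]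
  rw [h2]
  linear_combination uniformAmplitude_sq k₀ R

theorem star_mixerVec (k₀ : K) (R : Finset K) : star (mixerVec k₀ R) = mixerVec k₀ R := by
  ext k
  simp only [Pi.star_apply, mixerVec, uniformAmplitude, star_sub]
  congr 1 <;> split_ifs <;> simp

/-- The Householder matrix that exchanges `|k₀⟩` and the uniform superposition over `R ∪ {k₀}`. -/
def mixerMatrix (k₀ : K) (R : Finset K) : Matrix K K ℂ :=
  1 - (1 - uniformAmplitude k₀ R)⁻¹ • Matrix.vecMulVec (mixerVec k₀ R) (mixerVec k₀ R)

theorem mixerMatrix_mul_self (k₀ : K) (R : Finset K) :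
    mixerMatrix k₀ R * mixerMatrix k₀ R = 1 := by
  set c := (1 - uniformAmplitude k₀ R)⁻¹ with hc
  set W := Matrix.vecMulVec (mixerVec k₀ R) (mixerVec k₀ R) with hW
  have hWW : W * W = (2 * (1 - uniformAmplitude k₀ R)) • W := by
    rw [hW, Matrix.vecMulVec_mul_vecMulVec, dotProduct, sum_mixerVec_mul_self]
    ext i j
    simp [Matrix.vecMulVec_apply]; ring
  have hcc : c * c * (2 * (1 - uniformAmplitude k₀ R)) = 2 * c := by
    -- This happens when R ⊆ {k₀}; then the coefficient is 0⁻¹ = 0 and the matrix is the identity.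
    by_cases h : 1 - uniformAmplitude k₀ R = 0
    · simp [hc, h]
    · rw [hc]; field_simp
  rw [mixerMatrix, ← hc, ← hW, sub_mul, mul_sub, mul_sub, one_mul, one_mul, mul_one, smul_mul_smul,
    hWW, smul_smul, hcc, two_mul, add_smul]
  abel

theorem conjTranspose_mixerMatrix (k₀ : K) (R : Finset K) :
    (mixerMatrix k₀ R)ᴴ = mixerMatrix k₀ R := by
  have h : star (1 - uniformAmplitude k₀ R)⁻¹ = (1 - uniformAmplitude k₀ R)⁻¹ := by
    simp [uniformAmplitude]
  rw [mixerMatrix, Matrix.conjTranspose_sub, Matrix.conjTranspose_one, Matrix.conjTranspose_smul,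
    Matrix.conjTranspose_vecMulVec, star_mixerVec, h]

/-- The unitary that exchanges `|k₀⟩` and the uniform superposition over `R ∪ {k₀}`. -/
def mixer (k₀ : K) (R : Finset K) : Matrix.unitaryGroup K ℂ :=
  ⟨mixerMatrix k₀ R, by
    rw [Matrix.mem_unitaryGroup_iff, Matrix.star_eq_conjTranspose, conjTranspose_mixerMatrix,
      mixerMatrix_mul_self]⟩

end Mixer

/-! ### Reflections in coordinate subspaces -/

section CoordinateSubspace

variable {ι : Type*} [Fintype ι]

/-- The vectors that are supported on the coordinates with `p`. -/
def coordinateSubspace (p : ι → Prop) : Submodule ℂ (EuclideanSpace ℂ ι) where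
  carrier := {f | ∀ e, ¬p e → f e = 0}
  add_mem' hf hg e he := by
    rw [PiLp.add_apply, hf e he, hg e he, add_zero]
  zero_mem' _ _ := rfl
  smul_mem' c f hf e he := by
    rw [PiLp.smul_apply, hf e he, smul_zero]

theorem coordinateSubspace_starProjection (p : ι → Prop) [DecidablePred p]
    (f : EuclideanSpace ℂ ι) :
    (coordinateSubspace p).starProjection f = WithLp.toLp 2 fun e => if p e then f e else 0 := by
  have hmem : WithLp.toLp 2 (fun e => if p e then f e else 0) ∈ coordinateSubspace p :=
    fun e he => if_neg he
  refine Submodule.eq_starProjection_of_mem_of_inner_eq_zero hmem ?_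
  intro w hw
  rw [PiLp.inner_apply]
  refine Finset.sum_eq_zero fun e _ => ?_
  by_cases he : p e
  · simp [he]
  · simp [hw e he]

theorem coordinateSubspace_reflection_apply (p : ι → Prop) [DecidablePred p]
    (f : EuclideanSpace ℂ ι) (e : ι) :
    (coordinateSubspace p).reflection f e = if p e then f e else -f e := by
  rw [Submodule.reflection_apply, coordinateSubspace_starProjection]
  by_cases he : p e
  · simp [he, two_mul]
  · simp [he]

end CoordinateSubspace

/-! ### The action of each instruction on components, and the two reflections -/

section Gates

variable {X D : Type*} [Fintype X] [DecidableEq X] {K : Type} [Fintype K] [DecidableEq K]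
  {d : X → D} {zero : X} {P : Matrix X X ℝ} {pi : X → ℝ}

/-- The phase `-1` at the workspace states in `T`. -/
def signUnitary (T : Finset K) : Matrix.unitaryGroup K ℂ :=
  ⟨_, diagonal_sign_mem_unitaryGroup fun k => k ∈ T⟩

theorem slice_gateIso_work (O : UpdateOracle d zero P pi) (M : Finset X)
    (V : Matrix.unitaryGroup K ℂ) (ψ : EuclideanSpace ℂ (Edge d × K)) (k : K) :
    slice k (gateIso O M (.work V) ψ) = ∑ k', V.1 k k' • slice k' ψ := by
  ext e
  rw [slice_apply, ofLp_gateIso, Instr.op, Matrix.mulVec, dotProduct, Fintype.sum_prod_type,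
    Finset.sum_eq_single e]
  · simp [Matrix.kroneckerMap_apply, slice_apply]
  · intro e' _ he'
    simp [Matrix.kroneckerMap_apply, Matrix.one_apply_ne he'.symm]
  · simp

theorem slice_gateIso_mixer (O : UpdateOracle d zero P pi) (M : Finset X) (k₀ : K)
    (R : Finset K) (ψ : EuclideanSpace ℂ (Edge d × K)) (k : K) :
    slice k (gateIso O M (.work (mixer k₀ R)) ψ) = slice k ψ -
      ((1 - uniformAmplitude k₀ R)⁻¹ * mixerVec k₀ R k) •
        (slice k₀ ψ - uniformAmplitude k₀ R • ∑ k' ∈ insert k₀ R, slice k' ψ) := by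
  rw [slice_gateIso_work, ← sum_mixerVec_smul k₀ R fun k' => slice k' ψ, Finset.smul_sum]
  have h : ∀ k', (mixer k₀ R).1 k k' • slice k' ψ = (if k = k' then slice k' ψ else 0) -
      ((1 - uniformAmplitude k₀ R)⁻¹ * mixerVec k₀ R k) • mixerVec k₀ R k' • slice k' ψ := by
    intro k'
    simp only [mixer, mixerMatrix, Matrix.sub_apply, Matrix.smul_apply, Matrix.vecMulVec_apply,
      sub_smul, Matrix.one_apply, ite_smul, one_smul, zero_smul, smul_smul, smul_eq_mul, mul_assoc]
  simp_rw [h]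
  rw [Finset.sum_sub_distrib, Finset.sum_ite_eq, if_pos (Finset.mem_univ _)]

theorem slice_gateIso_mixer_of_notMem (O : UpdateOracle d zero P pi) (M : Finset X) {k₀ k : K}
    {R : Finset K} (hk : k ∉ insert k₀ R) (ψ : EuclideanSpace ℂ (Edge d × K)) :
    slice k (gateIso O M (.work (mixer k₀ R)) ψ) = slice k ψ := by
  rw [slice_gateIso_mixer, mixerVec_of_notMem hk, mul_zero, zero_smul, sub_zero]

theorem eq_of_uniformAmplitude_eq_one {k₀ k : K} {R : Finset K} (h : uniformAmplitude k₀ R = 1)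
    (hk : k ∈ insert k₀ R) : k = k₀ := by
  have h1 := uniformAmplitude_sq k₀ R
  rw [h, one_pow, one_mul] at h1
  have h2 : (insert k₀ R).card = 1 := by exact_mod_cast h1
  obtain ⟨a, ha⟩ := Finset.card_eq_one.1 h2
  have h3 : k₀ ∈ insert k₀ R := Finset.mem_insert_self _ _
  rw [ha, Finset.mem_singleton] at hk h3
  rw [hk, h3]

theorem slice_gateIso_mixer_self (O : UpdateOracle d zero P pi) (M : Finset X) (k₀ : K)
    (R : Finset K) (ψ : EuclideanSpace ℂ (Edge d × K)) :
    slice k₀ (gateIso O M (.work (mixer k₀ R)) ψ) =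
      uniformAmplitude k₀ R • ∑ k' ∈ insert k₀ R, slice k' ψ := by
  rw [slice_gateIso_mixer, mixerVec_self]
  by_cases h : uniformAmplitude k₀ R = 1
  · have hs : insert k₀ R = {k₀} := Finset.eq_singleton_iff_unique_mem.2
      ⟨Finset.mem_insert_self _ _, fun k hk => eq_of_uniformAmplitude_eq_one h hk⟩
    rw [h, hs, Finset.sum_singleton]; simp
  · rw [inv_mul_cancel₀ (sub_ne_zero.2 (Ne.symm h)), one_smul, sub_sub_cancel]

theorem slice_gateIso_mixer_of_mem (O : UpdateOracle d zero P pi) (M : Finset X) {k₀ k : K}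
    {R : Finset K} (hk : k ∈ insert k₀ R) {ψ : EuclideanSpace ℂ (Edge d × K)}
    (hψ : ∀ k ∈ R, k ≠ k₀ → slice k ψ = 0) :
    slice k (gateIso O M (.work (mixer k₀ R)) ψ) = uniformAmplitude k₀ R • slice k₀ ψ := by
  have hsum : ∑ k' ∈ insert k₀ R, slice k' ψ = slice k₀ ψ := by
    refine Finset.sum_eq_single k₀ (fun k' hk' hne => ?_) (by simp)
    exact hψ k' ((Finset.mem_insert.1 hk').resolve_left hne) hne
  by_cases hkk : k = k₀
  · rw [hkk, slice_gateIso_mixer_self, hsum]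
  · have hkR := (Finset.mem_insert.1 hk).resolve_left hkk
    have h : uniformAmplitude k₀ R ≠ 1 := fun h => hkk (eq_of_uniformAmplitude_eq_one h hk)
    have h' : 1 - uniformAmplitude k₀ R ≠ 0 := sub_ne_zero.2 (Ne.symm h)
    rw [slice_gateIso_mixer, hsum, mixerVec_of_mem hkR hkk, hψ k hkR hkk]
    have : slice k₀ ψ - uniformAmplitude k₀ R • slice k₀ ψ =
        (1 - uniformAmplitude k₀ R) • slice k₀ ψ := by rw [sub_smul, one_smul]
    rw [this, smul_smul, mul_right_comm, inv_mul_cancel₀ h', one_mul, neg_smul]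
    simp

theorem gateIso_mixer_mul_self (O : UpdateOracle d zero P pi) (M : Finset X) (k₀ : K)
    (R : Finset K) :
    gateIso O M (.work (mixer k₀ R)) * gateIso O M (.work (mixer k₀ R)) = 1 := by
  rw [gateIso, ← map_mul, ← map_one unitaryIso]
  congr 1
  refine Subtype.ext ?_
  change ((1 : Matrix (Edge d) (Edge d) ℂ) ⊗ₖ mixerMatrix k₀ R) *
    ((1 : Matrix (Edge d) (Edge d) ℂ) ⊗ₖ mixerMatrix k₀ R) = 1
  rw [← Matrix.mul_kronecker_mul, mixerMatrix_mul_self, mul_one, Matrix.one_kronecker_one]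

theorem slice_unitaryIso_kronecker_one {ι : Type*} [Fintype ι] [DecidableEq ι]
    (Q : Matrix.unitaryGroup ι ℂ) (h : Q.1 ⊗ₖ (1 : Matrix K K ℂ) ∈ Matrix.unitaryGroup (ι × K) ℂ)
    (ψ : EuclideanSpace ℂ (ι × K)) (k : K) :
    slice k (unitaryIso ⟨_, h⟩ ψ) = unitaryIso Q (slice k ψ) := by
  ext e
  rw [slice_apply, ofLp_unitaryIso, ofLp_unitaryIso, Matrix.mulVec, dotProduct,
    Fintype.sum_prod_type_right, Finset.sum_eq_single k]
  · simp [Matrix.kroneckerMap_apply, slice_apply, Matrix.mulVec, dotProduct]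
  · intro k' _ hk'
    simp [Matrix.kroneckerMap_apply, Matrix.one_apply_ne hk'.symm]
  · simp

theorem slice_gateIso_updateRight (O : UpdateOracle d zero P pi) (M : Finset X)
    (ψ : EuclideanSpace ℂ (Edge d × K)) (k : K) :
    slice k (gateIso O M .updateRight ψ) = unitaryIso O.right (slice k ψ) :=
  slice_unitaryIso_kronecker_one _ _ _ _

theorem slice_gateIso_updateRightInv (O : UpdateOracle d zero P pi) (M : Finset X)
    (ψ : EuclideanSpace ℂ (Edge d × K)) (k : K) :
    slice k (gateIso O M .updateRightInv ψ) = (unitaryIso O.right).symm (slice k ψ) := by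
  rw [show (unitaryIso O.right).symm = unitaryIso O.right⁻¹ from (map_inv unitaryIso _).symm]
  exact slice_unitaryIso_kronecker_one _ _ _ _

theorem slice_gateIso_updateLeft (O : UpdateOracle d zero P pi) (M : Finset X)
    (ψ : EuclideanSpace ℂ (Edge d × K)) (k : K) :
    slice k (gateIso O M .updateLeft ψ) = unitaryIso O.left (slice k ψ) :=
  slice_unitaryIso_kronecker_one _ _ _ _

theorem slice_gateIso_updateLeftInv (O : UpdateOracle d zero P pi) (M : Finset X)
    (ψ : EuclideanSpace ℂ (Edge d × K)) (k : K) :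
    slice k (gateIso O M .updateLeftInv ψ) = (unitaryIso O.left).symm (slice k ψ) := by
  rw [show (unitaryIso O.left).symm = unitaryIso O.left⁻¹ from (map_inv unitaryIso _).symm]
  exact slice_unitaryIso_kronecker_one _ _ _ _

theorem controlled_sign_eq {B : Type*} [DecidableEq B] (p : B → Prop) [DecidablePred p]
    (T : Finset K) : controlled p (signUnitary T).1 =
      Matrix.diagonal fun s : B × K => if p s.1 ∧ s.2 ∈ T then (-1 : ℂ) else 1 := by
  rw [controlled, signUnitary, ← Matrix.diagonal_one, Matrix.diagonal_kronecker_diagonal,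
    Matrix.diagonal_kronecker_diagonal, Matrix.diagonal_add]
  congr 1
  ext ⟨b, k⟩
  by_cases h : p b <;> simp [h]

theorem slice_of_ofLp_eq_sign {ι : Type*} [Fintype ι] [DecidableEq ι] {p : ι → Prop}
    [DecidablePred p] {T : Finset K} {ψ φ : EuclideanSpace ℂ (ι × K)}
    (h : φ.ofLp = (Matrix.diagonal fun s : ι × K => if p s.1 ∧ s.2 ∈ T then (-1 : ℂ) else 1) *ᵥ
      ψ.ofLp) (k : K) :
    slice k φ = if k ∈ T then -(coordinateSubspace p).reflection (slice k ψ) else slice k ψ := by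
  ext e
  rw [slice_apply, h, Matrix.mulVec_diagonal]
  by_cases hk : k ∈ T
  · rw [if_pos hk, PiLp.neg_apply, coordinateSubspace_reflection_apply]
    by_cases hp : p e <;> simp [hk, hp, slice_apply]
  · simp [hk, slice_apply]

theorem slice_gateIso_ifZeroFst (O : UpdateOracle d zero P pi) (M : Finset X) (T : Finset K)
    (ψ : EuclideanSpace ℂ (Edge d × K)) (k : K) :
    slice k (gateIso O M (.ifZeroFst (signUnitary T)) ψ) =
      if k ∈ T then
        -(coordinateSubspace fun e : Edge d => e.1 = DataState.of d zero).reflection (slice k ψ)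
      else slice k ψ :=
  slice_of_ofLp_eq_sign (by rw [ofLp_gateIso, Instr.op, controlled_sign_eq]) k

theorem slice_gateIso_ifZeroSnd (O : UpdateOracle d zero P pi) (M : Finset X) (T : Finset K)
    (ψ : EuclideanSpace ℂ (Edge d × K)) (k : K) :
    slice k (gateIso O M (.ifZeroSnd (signUnitary T)) ψ) =
      if k ∈ T then
        -(coordinateSubspace fun e : Edge d => e.2 = DataState.of d zero).reflection (slice k ψ)
      else slice k ψ :=
  slice_of_ofLp_eq_sign (by rw [ofLp_gateIso, Instr.op, controlled_sign_eq]) k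

variable (d) in
/-- The span of the `|x⟩_d |y⟩_d` with `x` marked. -/
def markedSubspace (M : Finset X) : Submodule ℂ (EuclideanSpace ℂ (Edge d)) :=
  coordinateSubspace fun e => e.1.state ∈ M

theorem slice_gateIso_check (O : UpdateOracle d zero P pi) (M : Finset X) (T : Finset K)
    (ψ : EuclideanSpace ℂ (Edge d × K)) (k : K) :
    slice k (gateIso O M (.check T) ψ) =
      if k ∈ T then -(markedSubspace d M).reflection (slice k ψ) else slice k ψ :=
  slice_of_ofLp_eq_sign rfl k

/-- The space spanned by the `|x⟩_d ∑_y √p_{xy} |y⟩_d`. -/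
def UpdateOracle.rightSpace (O : UpdateOracle d zero P pi) :
    Submodule ℂ (EuclideanSpace ℂ (Edge d)) :=
  (coordinateSubspace fun e : Edge d => e.2 = DataState.of d zero).map
    ((unitaryIso O.right).toLinearEquiv : EuclideanSpace ℂ (Edge d) →ₗ[ℂ] EuclideanSpace ℂ (Edge d))

/-- The space spanned by the `∑_x √p*_{yx} |x⟩_d |y⟩_d`. -/
def UpdateOracle.leftSpace (O : UpdateOracle d zero P pi) :
    Submodule ℂ (EuclideanSpace ℂ (Edge d)) :=
  (coordinateSubspace fun e : Edge d => e.1 = DataState.of d zero).map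
    ((unitaryIso O.left).toLinearEquiv : EuclideanSpace ℂ (Edge d) →ₗ[ℂ] EuclideanSpace ℂ (Edge d))

/-- The reflection in `rightSpace`, up to sign, controlled by the workspace. -/
def reflectRight (T : Finset K) : List (Instr K) :=
  [.updateRightInv, .ifZeroSnd (signUnitary T), .updateRight]

/-- The reflection in `leftSpace`, up to sign, controlled by the workspace. -/
def reflectLeft (T : Finset K) : List (Instr K) :=
  [.updateLeftInv, .ifZeroFst (signUnitary T), .updateLeft]

/-- Conjugation by the update carries the coordinate reflection to the reflection in the image
space. A phase flip is minus a reflection; in the walk the two signs cancel. -/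
theorem slice_reflectRight (O : UpdateOracle d zero P pi) (M : Finset X) (T : Finset K)
    (ψ : EuclideanSpace ℂ (Edge d × K)) (k : K) :
    slice k (circuitIso O M (reflectRight T) ψ) =
      if k ∈ T then -O.rightSpace.reflection (slice k ψ) else slice k ψ := by
  change slice k (gateIso O M .updateRight (gateIso O M (.ifZeroSnd (signUnitary T))
    (gateIso O M .updateRightInv ψ))) = _
  rw [slice_gateIso_updateRight, slice_gateIso_ifZeroSnd, slice_gateIso_updateRightInv]
  split_ifs
  · rw [map_neg, ← Submodule.reflection_map_apply]; rfl
  · exact LinearIsometryEquiv.apply_symm_apply _ _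

theorem slice_reflectLeft (O : UpdateOracle d zero P pi) (M : Finset X) (T : Finset K)
    (ψ : EuclideanSpace ℂ (Edge d × K)) (k : K) :
    slice k (circuitIso O M (reflectLeft T) ψ) =
      if k ∈ T then -O.leftSpace.reflection (slice k ψ) else slice k ψ := by
  change slice k (gateIso O M .updateLeft (gateIso O M (.ifZeroFst (signUnitary T))
    (gateIso O M .updateLeftInv ψ))) = _
  rw [slice_gateIso_updateLeft, slice_gateIso_ifZeroFst, slice_gateIso_updateLeftInv]
  split_ifs
  · rw [map_neg, ← Submodule.reflection_map_apply]; rfl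
  · exact LinearIsometryEquiv.apply_symm_apply _ _

/-- The walk operator. -/
abbrev UpdateOracle.walk (O : UpdateOracle d zero P pi) :
    EuclideanSpace ℂ (Edge d) ≃ₗᵢ[ℂ] EuclideanSpace ℂ (Edge d) :=
  QuantumSearch.walk O.rightSpace O.leftSpace

end Gates

/-! ### Geometry of the two walk spaces -/

section WalkSpaces

open scoped InnerProductSpace

variable {X D : Type*} [Fintype X] [DecidableEq X] {d : X → D} {zero : X} {P : Matrix X X ℝ}
  {pi : X → ℝ}

theorem DataState.of_state (s : DataState d) : DataState.of d s.state = s :=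
  (DataState.equivState d).symm_apply_apply s

theorem DataState.of_injective : Function.Injective (DataState.of d) :=
  (DataState.equivState d).symm.injective

theorem sum_edge {V : Type*} [AddCommMonoid V] (F : Edge d → V) :
    ∑ e, F e = ∑ x, ∑ y, F (DataState.of d x, DataState.of d y) := by
  rw [Fintype.sum_prod_type, ← Equiv.sum_comp (DataState.equivState d).symm]
  refine Finset.sum_congr rfl fun x _ => ?_
  rw [← Equiv.sum_comp (DataState.equivState d).symm]
  rfl

theorem ket_apply (x y x' y' : X) :
    ket d x y (DataState.of d x', DataState.of d y') = if x' = x ∧ y' = y then 1 else 0 := by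
  simp [ket, Pi.single_apply, DataState.of_injective.eq_iff]

theorem ext_edge {f g : Edge d → ℂ}
    (h : ∀ x y, f (DataState.of d x, DataState.of d y) = g (DataState.of d x, DataState.of d y)) :
    f = g := by
  ext ⟨s, t⟩
  have := h s.state t.state
  rwa [DataState.of_state, DataState.of_state] at this

theorem UpdateOracle.right_mulVec_sum (O : UpdateOracle d zero P pi) (c : X → ℂ) (x y : X) :
    (O.right.1 *ᵥ ∑ x, c x • ket d x zero) (DataState.of d x, DataState.of d y) =
      c x * √(P x y) := by
  rw [Matrix.mulVec_sum]
  simp_rw [Matrix.mulVec_smul, O.right_apply]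
  rw [Finset.sum_apply, Finset.sum_eq_single x, Pi.smul_apply, Finset.sum_apply,
    Finset.sum_eq_single y]
  · simp [ket_apply]
  · intro y' _ h; simp [ket_apply, h.symm]
  · simp
  · intro x' _ h
    simp [ket_apply, h.symm]
  · simp

theorem UpdateOracle.left_mulVec_sum (O : UpdateOracle d zero P pi) (c : X → ℂ) (x y : X) :
    (O.left.1 *ᵥ ∑ y, c y • ket d zero y) (DataState.of d x, DataState.of d y) =
      c y * √(timeReversal P pi y x) := by
  rw [Matrix.mulVec_sum]
  simp_rw [Matrix.mulVec_smul, O.left_apply]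
  rw [Finset.sum_apply, Finset.sum_eq_single y, Pi.smul_apply, Finset.sum_apply,
    Finset.sum_eq_single x]
  · simp [ket_apply]
  · intro y' _ h; simp [ket_apply, h.symm]
  · simp
  · intro x' _ h
    simp [ket_apply, h.symm]
  · simp

/-- Only the prescribed action of the update enters here, so its arbitrary action on other basis
vectors is harmless. -/
theorem UpdateOracle.exists_of_mem_rightSpace (O : UpdateOracle d zero P pi)
    {a : EuclideanSpace ℂ (Edge d)} (ha : a ∈ O.rightSpace) :
    ∃ c : X → ℂ, ∀ x y, a (DataState.of d x, DataState.of d y) = c x * √(P x y) := by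
  obtain ⟨f, hf, rfl⟩ := Submodule.mem_map.1 ha
  refine ⟨fun x => f (DataState.of d x, DataState.of d zero), fun x y => ?_⟩
  have h : f.ofLp = ∑ x, f (DataState.of d x, DataState.of d zero) • ket d x zero := by
    refine ext_edge fun x' y' => ?_
    rw [Finset.sum_apply, Finset.sum_eq_single x']
    · by_cases hy : y' = zero
      · simp [ket_apply, hy]
      · have := hf (DataState.of d x', DataState.of d y')
          (fun h => hy (DataState.of_injective h))
        simp [ket_apply, hy, this]
    · intro x'' _ h; simp [ket_apply, h.symm]
    · simp
  refine Eq.trans ?_ (O.right_mulVec_sum (fun x => f (DataState.of d x, DataState.of d zero)) x y)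
  rw [← h]; rfl

theorem UpdateOracle.exists_of_mem_leftSpace (O : UpdateOracle d zero P pi)
    {b : EuclideanSpace ℂ (Edge d)} (hb : b ∈ O.leftSpace) :
    ∃ c : X → ℂ, ∀ x y,
      b (DataState.of d x, DataState.of d y) = c y * √(timeReversal P pi y x) := by
  obtain ⟨f, hf, rfl⟩ := Submodule.mem_map.1 hb
  refine ⟨fun y => f (DataState.of d zero, DataState.of d y), fun x y => ?_⟩
  have h : f.ofLp = ∑ y, f (DataState.of d zero, DataState.of d y) • ket d zero y := by
    refine ext_edge fun x' y' => ?_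
    rw [Finset.sum_apply, Finset.sum_eq_single y']
    · by_cases hx : x' = zero
      · simp [ket_apply, hx]
      · have := hf (DataState.of d x', DataState.of d y')
          (fun h => hx (DataState.of_injective h))
        simp [ket_apply, hx, this]
    · intro x'' _ h; simp [ket_apply, h.symm]
    · simp
  refine Eq.trans ?_ (O.left_mulVec_sum (fun y => f (DataState.of d zero, DataState.of d y)) x y)
  rw [← h]; rfl

variable (d zero pi) in
/-- The state `∑_x √pi_x |x⟩_d |0⟩_d`. -/
def setupState : EuclideanSpace ℂ (Edge d) :=
  WithLp.toLp 2 (∑ x : X, (√(pi x) : ℂ) • ket d x zero)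

/-- The state `∑_x √pi_x |x⟩_d ∑_y √p_{xy} |y⟩_d`. -/
def UpdateOracle.stationaryState (O : UpdateOracle d zero P pi) : EuclideanSpace ℂ (Edge d) :=
  unitaryIso O.right (setupState d zero pi)

theorem UpdateOracle.stationaryState_apply (O : UpdateOracle d zero P pi) (x y : X) :
    O.stationaryState (DataState.of d x, DataState.of d y) = √(pi x) * √(P x y) :=
  O.right_mulVec_sum _ x y

theorem norm_sq_setupState (hpi : IsStationaryDistribution P pi) :
    ‖setupState d zero pi‖ ^ 2 = 1 := by
  have h : ∀ x y, setupState d zero pi (DataState.of d x, DataState.of d y) =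
      if y = zero then (√(pi x) : ℂ) else 0 := by
    intro x y
    rw [setupState, PiLp.toLp_apply, Finset.sum_apply, Finset.sum_eq_single x]
    · simp [ket_apply]
    · intro x' _ h; simp [ket_apply, h.symm]
    · simp
  rw [EuclideanSpace.norm_sq_eq, sum_edge]
  simp_rw [h]
  have h2 : ∀ x y : X, ‖if y = zero then (√(pi x) : ℂ) else 0‖ ^ 2 =
      if y = zero then pi x else 0 := by
    intro x y
    split_ifs
    · rw [Complex.norm_real, Real.norm_of_nonneg (Real.sqrt_nonneg _),
        Real.sq_sqrt (hpi.1.1 x)]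
    · simp
  simp_rw [h2, Finset.sum_ite_eq', Finset.mem_univ, if_true]
  exact hpi.1.2

theorem norm_setupState (hpi : IsStationaryDistribution P pi) : ‖setupState d zero pi‖ = 1 :=
  (sq_eq_sq₀ (norm_nonneg _) zero_le_one).1 ((norm_sq_setupState hpi).trans (one_pow 2).symm)

theorem UpdateOracle.norm_stationaryState (O : UpdateOracle d zero P pi)
    (hpi : IsStationaryDistribution P pi) : ‖O.stationaryState‖ = 1 := by
  rw [stationaryState, LinearIsometryEquiv.norm_map, norm_setupState hpi]

theorem sqrt_mul_sqrt_timeReversal (hP : ∀ x y, 0 ≤ P x y) (hpos : ∀ x, 0 < pi x) (x y : X) :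
    √(P x y) * √(timeReversal P pi y x) = discriminant P pi x y := by
  rw [timeReversal, Matrix.of_apply, Real.sqrt_div (mul_nonneg (hpos x).le (hP x y)),
    Real.sqrt_mul (hpos x).le, discriminant_apply]
  nth_rewrite 3 [← Real.mul_self_sqrt (hP x y)]
  rw [div_eq_mul_inv]; ring

theorem sqrt_mul_sqrt_eq (hpos : ∀ x, 0 < pi x) (x y : X) :
    √(pi x) * √(P x y) = √(pi y) * √(timeReversal P pi y x) := by
  rw [← Real.sqrt_mul (hpos x).le, ← Real.sqrt_mul (hpos y).le, timeReversal, Matrix.of_apply,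
    mul_div_cancel₀ _ (hpos y).ne']

theorem UpdateOracle.stationaryState_mem_rightSpace (O : UpdateOracle d zero P pi) :
    O.stationaryState ∈ O.rightSpace := by
  refine Submodule.mem_map_of_mem fun e he => ?_
  rw [setupState, PiLp.toLp_apply, Finset.sum_apply]
  refine Finset.sum_eq_zero fun x _ => ?_
  rw [Pi.smul_apply, ket, Pi.single_eq_of_ne (fun h => he (congrArg Prod.snd h)), smul_zero]

/-- Since π_x p_xy = π_y p*_yx, the same vector is the left update of ∑√π_y|0⟩|y⟩. -/
theorem UpdateOracle.stationaryState_mem_leftSpace (O : UpdateOracle d zero P pi)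
    (hpos : ∀ x, 0 < pi x) : O.stationaryState ∈ O.leftSpace := by
  have h : O.stationaryState = unitaryIso O.left
      (WithLp.toLp 2 (∑ y : X, (√(pi y) : ℂ) • ket d zero y)) := by
    refine WithLp.ofLp_injective 2 (ext_edge fun x y => ?_)
    rw [O.stationaryState_apply, ofLp_unitaryIso, O.left_mulVec_sum]
    exact_mod_cast sqrt_mul_sqrt_eq hpos x y
  rw [h]
  refine Submodule.mem_map_of_mem fun e he => ?_
  rw [PiLp.toLp_apply, Finset.sum_apply]
  refine Finset.sum_eq_zero fun x _ => ?_
  rw [Pi.smul_apply, ket, Pi.single_eq_of_ne (fun h => he (congrArg Prod.fst h)), smul_zero]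

theorem norm_eq_of_apply_eq_mul_sqrt {f : EuclideanSpace ℂ (Edge d)} {c : X → ℂ}
    {Q : X → X → ℝ} (hQ : ∀ x y, 0 ≤ Q x y) (hQ1 : ∀ x, ∑ y, Q x y = 1)
    (hf : ∀ x y, f (DataState.of d x, DataState.of d y) = c x * √(Q x y)) :
    ‖f‖ = ‖(WithLp.toLp 2 c : EuclideanSpace ℂ X)‖ := by
  refine (sq_eq_sq₀ (norm_nonneg _) (norm_nonneg _)).1 ?_
  rw [EuclideanSpace.norm_sq_eq, EuclideanSpace.norm_sq_eq, sum_edge]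
  refine Finset.sum_congr rfl fun x _ => ?_
  simp_rw [hf, norm_mul, mul_pow, Complex.norm_real, Real.norm_eq_abs, sq_abs,
    Real.sq_sqrt (hQ x _), ← Finset.mul_sum, hQ1, mul_one]

theorem norm_eq_of_apply_eq_mul_sqrt' {f : EuclideanSpace ℂ (Edge d)} {c : X → ℂ}
    {Q : X → X → ℝ} (hQ : ∀ x y, 0 ≤ Q x y) (hQ1 : ∀ x, ∑ y, Q x y = 1)
    (hf : ∀ x y, f (DataState.of d x, DataState.of d y) = c y * √(Q y x)) :
    ‖f‖ = ‖(WithLp.toLp 2 c : EuclideanSpace ℂ X)‖ := by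
  refine (sq_eq_sq₀ (norm_nonneg _) (norm_nonneg _)).1 ?_
  rw [EuclideanSpace.norm_sq_eq, EuclideanSpace.norm_sq_eq, sum_edge, Finset.sum_comm]
  refine Finset.sum_congr rfl fun x _ => ?_
  simp_rw [hf, norm_mul, mul_pow, Complex.norm_real, Real.norm_eq_abs, sq_abs,
    Real.sq_sqrt (hQ x _), ← Finset.mul_sum, hQ1, mul_one]

/-- From √p_xy √p*_yx = D(P)_xy the inner product becomes the form of D(P) in the coefficient
vectors, whose norms are those of a and b. As D(P)ᵀ fixes √π, orthogonality of b to the stationary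
state becomes orthogonality of its coefficients to √π. -/
theorem UpdateOracle.norm_inner_le (O : UpdateOracle d zero P pi) {δ : ℝ}
    (hP : P ∈ Matrix.rowStochastic ℝ X) (hpi : IsStationaryDistribution P pi)
    (hpos : ∀ x, 0 < pi x) (hgap : singularValueGap (discriminant P pi) = δ) (hδ : 0 < δ)
    {a b : EuclideanSpace ℂ (Edge d)} (ha : a ∈ O.rightSpace) (hb : b ∈ O.leftSpace)
    (hpb : ⟪O.stationaryState, b⟫_ℂ = 0) : ‖⟪a, b⟫_ℂ‖ ≤ (1 - δ) * ‖a‖ * ‖b‖ := by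
  have hP0 : ∀ x y, 0 ≤ P x y := fun x y => Matrix.nonneg_of_mem_rowStochastic hP
  obtain ⟨α, hα⟩ := O.exists_of_mem_rightSpace ha
  obtain ⟨β, hβ⟩ := O.exists_of_mem_leftSpace hb
  have hinner : ∀ (f : EuclideanSpace ℂ (Edge d)) (γ : X → ℂ),
      (∀ x y, f (DataState.of d x, DataState.of d y) = γ x * √(P x y)) →
      ⟪f, b⟫_ℂ = ∑ x, ∑ y, star (γ x) * (discriminant P pi x y : ℂ) * β y := by
    intro f γ hγ
    rw [PiLp.inner_apply, sum_edge]
    refine Finset.sum_congr rfl fun x _ => Finset.sum_congr rfl fun y _ => ?_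
    rw [hγ, hβ, ← sqrt_mul_sqrt_timeReversal hP0 hpos, RCLike.inner_apply]
    rw [map_mul, Complex.conj_ofReal, Complex.ofReal_mul, starRingEnd_apply]
    ring
  have hT : ∀ y x, 0 ≤ timeReversal P pi y x := fun y x =>
    div_nonneg (mul_nonneg (hpos x).le (hP0 x y)) (hpos y).le
  have hT1 : ∀ y, ∑ x, timeReversal P pi y x = 1 := by
    intro y
    simp_rw [timeReversal, Matrix.of_apply, ← Finset.sum_div]
    rw [show ∑ x, pi x * P x y = pi y from congrFun hpi.2 y, div_self (hpos y).ne']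
  rw [hinner a α hα, norm_eq_of_apply_eq_mul_sqrt hP0
    (fun x => Matrix.sum_row_of_mem_rowStochastic hP x) hα,
    norm_eq_of_apply_eq_mul_sqrt' hT hT1 hβ]
  refine norm_sum_discriminant_le hP hpi hpos hgap hδ (WithLp.toLp 2 α) (WithLp.toLp 2 β) ?_
  rw [← hpb, hinner _ _ O.stationaryState_apply, Finset.sum_comm]
  refine Finset.sum_congr rfl fun y _ => ?_
  rw [← Finset.sum_mul]
  congr 1
  have h := congrFun (discriminant_transpose_mulVec_sqrt hpi hpos) y
  simp only [Matrix.mulVec, dotProduct, Matrix.transpose_apply] at h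
  rw [← h]
  push_cast
  refine Finset.sum_congr rfl fun x _ => ?_
  simp [mul_comm]

end WalkSpaces

/-! ### The approximate reflection in the stationary state -/

section ApproximateReflection

open scoped InnerProductSpace

variable {X D : Type*} [Fintype X] [DecidableEq X] {K : Type} [Fintype K] [DecidableEq K]
  {d : X → D} {zero : X} {P : Matrix X X ℝ} {pi : X → ℝ}

/-- The power `n` of the walk operator at the workspace states `k` with `pw k = n`. -/
def walkPowers (pw : K → ℕ) (N : ℕ) : List (Instr K) :=
  (List.range N).flatMap fun m =>
    reflectRight (Finset.univ.filter fun k => m < pw k) ++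
      reflectLeft (Finset.univ.filter fun k => m < pw k)

/-- The inverse of `walkPowers`. -/
def walkPowersInv (pw : K → ℕ) (N : ℕ) : List (Instr K) :=
  (List.range N).flatMap fun m =>
    reflectLeft (Finset.univ.filter fun k => m < pw k) ++
      reflectRight (Finset.univ.filter fun k => m < pw k)

/-- Step m acts only at the workspace states with m < pw k, so a component collects one factor of
the walk for each such m below N. -/
theorem slice_walkPowers (O : UpdateOracle d zero P pi) (M : Finset X) (pw : K → ℕ) (N : ℕ)
    (ψ : EuclideanSpace ℂ (Edge d × K)) (k : K) :
    slice k (circuitIso O M (walkPowers pw N) ψ) = (O.walk ^ min N (pw k)) (slice k ψ) := by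
  induction N with
  | zero => rw [Nat.zero_min]; rfl
  | succ N ih =>
    rw [walkPowers, List.range_succ, List.flatMap_append, List.flatMap_singleton,
      circuitIso_append_apply, circuitIso_append_apply, slice_reflectLeft, slice_reflectRight,
      ← walkPowers, ih]
    by_cases h : N < pw k
    · have h1 : min (N + 1) (pw k) = min N (pw k) + 1 := by omega
      simp only [Finset.mem_filter, Finset.mem_univ, true_and, h, if_true, map_neg, neg_neg]
      rw [h1, pow_succ']; rfl
    · have h1 : min (N + 1) (pw k) = min N (pw k) := by omega
      simp only [Finset.mem_filter, Finset.mem_univ, true_and, h, if_false]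
      rw [h1]

theorem slice_walkPowersInv (O : UpdateOracle d zero P pi) (M : Finset X) (pw : K → ℕ) (N : ℕ)
    (ψ : EuclideanSpace ℂ (Edge d × K)) (k : K) :
    slice k (circuitIso O M (walkPowersInv pw N) ψ) =
      (O.walk⁻¹ ^ min N (pw k)) (slice k ψ) := by
  induction N with
  | zero => rw [Nat.zero_min]; rfl
  | succ N ih =>
    rw [walkPowersInv, List.range_succ, List.flatMap_append, List.flatMap_singleton,
      circuitIso_append_apply, circuitIso_append_apply, slice_reflectRight, slice_reflectLeft,
      ← walkPowersInv, ih]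
    by_cases h : N < pw k
    · have h1 : min (N + 1) (pw k) = min N (pw k) + 1 := by omega
      simp only [Finset.mem_filter, Finset.mem_univ, true_and, h, if_true, map_neg, neg_neg]
      rw [h1, pow_succ', UpdateOracle.walk, walk_inv]; rfl
    · have h1 : min (N + 1) (pw k) = min N (pw k) := by omega
      simp only [Finset.mem_filter, Finset.mem_univ, true_and, h, if_false]
      rw [h1]

theorem circuitIso_walkPowersInv (O : UpdateOracle d zero P pi) (M : Finset X) (pw : K → ℕ)
    (N : ℕ) : circuitIso O M (walkPowersInv pw N) = (circuitIso O M (walkPowers pw N))⁻¹ := by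
  rw [eq_inv_iff_mul_eq_one]
  refine LinearIsometryEquiv.ext fun ψ => ext_slice fun k => ?_
  change slice k (circuitIso O M (walkPowersInv pw N) (circuitIso O M (walkPowers pw N) ψ)) = _
  rw [slice_walkPowersInv, slice_walkPowers, inv_pow]
  exact LinearIsometryEquiv.symm_apply_apply _ _

/-- The workspace states `R ∪ {k₀}` count the numbers `0, …, N - 1`. -/
structure IsClock (k₀ : K) (R : Finset K) (pw : K → ℕ) (N : ℕ) : Prop where
  injOn : Set.InjOn pw (insert k₀ R : Finset K)
  image_eq : (insert k₀ R).image pw = Finset.range N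
  eq_zero : ∀ k ∉ insert k₀ R, pw k = 0

theorem IsClock.card {k₀ : K} {R : Finset K} {pw : K → ℕ} {N : ℕ} (h : IsClock k₀ R pw N) :
    (insert k₀ R).card = N := by
  rw [← Finset.card_image_of_injOn h.injOn, h.image_eq, Finset.card_range]

theorem IsClock.min_eq {k₀ : K} {R : Finset K} {pw : K → ℕ} {N : ℕ} (h : IsClock k₀ R pw N)
    (k : K) : min N (pw k) = pw k := by
  by_cases hk : k ∈ insert k₀ R
  · have : pw k ∈ Finset.range N := h.image_eq ▸ Finset.mem_image_of_mem pw hk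
    exact min_eq_right (Finset.mem_range.1 this).le
  · rw [h.eq_zero k hk, Nat.min_zero]

/-- Uniform superposition over the clock, powers of the walk, and back. -/
def average (k₀ : K) (R : Finset K) (pw : K → ℕ) (N : ℕ) : List (Instr K) :=
  [.work (mixer k₀ R)] ++ walkPowers pw N ++ [.work (mixer k₀ R)]

/-- The inverse of `average`. -/
def averageInv (k₀ : K) (R : Finset K) (pw : K → ℕ) (N : ℕ) : List (Instr K) :=
  [.work (mixer k₀ R)] ++ walkPowersInv pw N ++ [.work (mixer k₀ R)]

/-- The approximate reflection in the stationary state. -/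
def approxReflection (k₀ : K) (R : Finset K) (pw : K → ℕ) (N : ℕ) : List (Instr K) :=
  average k₀ R pw N ++ reflectRight {k₀} ++ averageInv k₀ R pw N

variable (O : UpdateOracle d zero P pi) (M : Finset X) (k₀ : K) (R : Finset K) (pw : K → ℕ)
  (N : ℕ)

theorem circuitIso_singleton (g : Instr K) : circuitIso O M [g] = gateIso O M g := one_mul _

theorem gateIso_mixer_inv :
    (gateIso O M (.work (mixer k₀ R)))⁻¹ = gateIso O M (.work (mixer k₀ R)) :=
  inv_eq_of_mul_eq_one_left (gateIso_mixer_mul_self O M k₀ R)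

theorem circuitIso_average : circuitIso O M (average k₀ R pw N) =
    gateIso O M (.work (mixer k₀ R)) * (circuitIso O M (walkPowers pw N) *
      gateIso O M (.work (mixer k₀ R))) := by
  rw [average, circuitIso_append, circuitIso_append, circuitIso_singleton]

theorem circuitIso_averageInv :
    circuitIso O M (averageInv k₀ R pw N) = (circuitIso O M (average k₀ R pw N))⁻¹ := by
  rw [circuitIso_average, averageInv, circuitIso_append, circuitIso_append, circuitIso_singleton,
    circuitIso_walkPowersInv, mul_inv_rev, mul_inv_rev, gateIso_mixer_inv, mul_assoc]

theorem circuitIso_approxReflection : circuitIso O M (approxReflection k₀ R pw N) =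
    (circuitIso O M (average k₀ R pw N))⁻¹ *
      (circuitIso O M (reflectRight {k₀}) * circuitIso O M (average k₀ R pw N)) := by
  rw [approxReflection, circuitIso_append, circuitIso_append, circuitIso_averageInv]

theorem reflectRight_mul_self (T : Finset K) :
    circuitIso O M (reflectRight T) * circuitIso O M (reflectRight T) = 1 := by
  refine LinearIsometryEquiv.ext fun ψ => ext_slice fun k => ?_
  change slice k (circuitIso O M (reflectRight T) (circuitIso O M (reflectRight T) ψ)) = _
  rw [slice_reflectRight, slice_reflectRight]
  split_ifs
  · rw [map_neg, Submodule.reflection_reflection, neg_neg]; rfl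
  · rfl

theorem circuitIso_approxReflection_inv :
    (circuitIso O M (approxReflection k₀ R pw N))⁻¹ =
      circuitIso O M (approxReflection k₀ R pw N) := by
  rw [circuitIso_approxReflection, mul_inv_rev, mul_inv_rev, inv_inv,
    inv_eq_of_mul_eq_one_left (reflectRight_mul_self O M {k₀}), mul_assoc]

theorem reflectRight_singleton_apply (ψ : EuclideanSpace ℂ (Edge d × K)) :
    circuitIso O M (reflectRight {k₀}) ψ =
      ψ - (2 : ℂ) • embed k₀ (O.rightSpace.starProjection (slice k₀ ψ)) := by
  refine ext_slice fun k => ?_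
  rw [slice_reflectRight, map_sub, map_smul]
  by_cases hk : k = k₀
  · rw [if_pos (Finset.mem_singleton.2 hk), hk, slice_embed_self, Submodule.reflection_apply,
      neg_sub, two_smul, two_smul]
  · rw [if_neg (fun h => hk (Finset.mem_singleton.1 h)), slice_embed_of_ne hk, smul_zero, sub_zero]

variable {k₀ R pw N}

theorem isTrivialOn_mixer : IsTrivialOn {k | k ∉ insert k₀ R}
    (gateIso O M (.work (mixer k₀ R))) :=
  fun ψ _ hk => slice_gateIso_mixer_of_notMem O M hk ψ

theorem isTrivialOn_average (h : IsClock k₀ R pw N) :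
    IsTrivialOn {k | k ∉ insert k₀ R} (circuitIso O M (average k₀ R pw N)) := by
  rw [circuitIso_average]
  refine (isTrivialOn_mixer O M).mul (IsTrivialOn.mul ?_ (isTrivialOn_mixer O M))
  intro ψ k hk
  rw [slice_walkPowers, h.eq_zero k hk, Nat.min_zero]; rfl

theorem isTrivialOn_approxReflection (h : IsClock k₀ R pw N) :
    IsTrivialOn {k | k ∉ insert k₀ R} (circuitIso O M (approxReflection k₀ R pw N)) := by
  rw [circuitIso_approxReflection]
  refine (isTrivialOn_average O M h).inv.mul (IsTrivialOn.mul ?_ (isTrivialOn_average O M h))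
  intro ψ k hk
  rw [slice_reflectRight, if_neg]
  exact fun h' => hk (Finset.mem_insert.2 (Or.inl (Finset.mem_singleton.1 h')))

/-- Spreading the start over the clock and reading it back each contribute a factor N^(-1/2), and
the clock meets every exponent below N exactly once. -/
theorem slice_average_self (h : IsClock k₀ R pw N) {ψ : EuclideanSpace ℂ (Edge d × K)}
    (hψ : ∀ k ∈ R, k ≠ k₀ → slice k ψ = 0) :
    slice k₀ (circuitIso O M (average k₀ R pw N) ψ) =
      ((N : ℂ)⁻¹) • ∑ n ∈ Finset.range N, (O.walk ^ n) (slice k₀ ψ) := by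
  have hs := uniformAmplitude_sq k₀ R
  rw [h.card] at hs
  have hs' : uniformAmplitude k₀ R * uniformAmplitude k₀ R = (N : ℂ)⁻¹ := by
    rw [← sq]; exact eq_inv_of_mul_eq_one_left hs
  rw [circuitIso_average]
  change slice k₀ (gateIso O M (.work (mixer k₀ R)) (circuitIso O M (walkPowers pw N)
    (gateIso O M (.work (mixer k₀ R)) ψ))) = _
  rw [slice_gateIso_mixer_self, ← h.image_eq, Finset.sum_image h.injOn, ← hs', ← smul_smul]
  congr 1
  rw [Finset.smul_sum]
  refine Finset.sum_congr rfl fun k hk => ?_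
  rw [slice_walkPowers, h.min_eq, slice_gateIso_mixer_of_mem O M hk hψ, map_smul]

/-- The conjugated flip differs from the identity by twice the A-part of the component at k₀ after
averaging. With an empty clock that component is the mean of the walk powers. Workspace states
outside the clock may be occupied arbitrarily. -/
theorem norm_approxReflection_sub_le {δ β : ℝ}
    (hP : P ∈ Matrix.rowStochastic ℝ X) (hpi : IsStationaryDistribution P pi)
    (hpos : ∀ x, 0 < pi x) (hgap : singularValueGap (discriminant P pi) = δ) (hδ : 0 < δ)
    (h : IsClock k₀ R pw N) (hβ : 2 ≤ β * (N * √δ)) (hN : 0 < N)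
    {ψ : EuclideanSpace ℂ (Edge d × K)} (hψ : ∀ k ∈ R, k ≠ k₀ → slice k ψ = 0)
    (horth : ⟪O.stationaryState, slice k₀ ψ⟫_ℂ = 0) :
    ‖circuitIso O M (approxReflection k₀ R pw N) ψ - ψ‖ ≤ β * ‖ψ‖ := by
  set V := circuitIso O M (average k₀ R pw N) with hV
  set y := O.rightSpace.starProjection (∑ n ∈ Finset.range N, (O.walk ^ n) (slice k₀ ψ)) with hy
  have h1 : circuitIso O M (approxReflection k₀ R pw N) ψ - ψ =
      -V⁻¹ ((2 : ℂ) • embed k₀ ((N : ℂ)⁻¹ • y)) := by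
    rw [circuitIso_approxReflection]
    change V⁻¹ (circuitIso O M (reflectRight {k₀}) (V ψ)) - ψ = _
    rw [reflectRight_singleton_apply, map_sub, slice_average_self O M h hψ, map_smul _ (N : ℂ)⁻¹,
      ← hy, show V⁻¹ (V ψ) = ψ from V.symm_apply_apply ψ]
    abel
  have hkey : √δ * ‖y‖ ≤ ‖slice k₀ ψ‖ :=
    norm_starProjection_sum_walk_le (gap_le_one hgap) hδ O.stationaryState_mem_rightSpace
      (O.stationaryState_mem_leftSpace hpos)
      (fun a ha b hb _ hpb => O.norm_inner_le hP hpi hpos hgap hδ ha hb hpb) horth N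
  have hN' : (0 : ℝ) < N := by exact_mod_cast hN
  have hδ' : 0 < √δ := Real.sqrt_pos.2 hδ
  have hβ0 : 0 < β := by
    by_contra! hneg
    have := mul_nonpos_of_nonpos_of_nonneg hneg (mul_pos hN' hδ').le
    linarith
  rw [h1, norm_neg, LinearIsometryEquiv.norm_map, norm_smul, norm_embed, norm_smul]
  simp only [Complex.norm_ofNat, norm_inv, Complex.norm_natCast]
  calc 2 * ((N : ℝ)⁻¹ * ‖y‖) ≤ β * (N * √δ) * ((N : ℝ)⁻¹ * ‖y‖) := by gcongr
    _ = β * (√δ * ‖y‖) := by field_simp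
    _ ≤ β * ‖ψ‖ := by gcongr; exact hkey.trans (norm_slice_le k₀ ψ)

/-- All powers of the walk fix the stationary state, so the two mixers cancel; the reflection is
therefore exact on this state. -/
theorem average_apply_stationaryState (hpos : ∀ x, 0 < pi x) :
    circuitIso O M (average k₀ R pw N) (embed k₀ O.stationaryState) =
      embed k₀ O.stationaryState := by
  set p : EuclideanSpace ℂ (Edge d × K) := embed k₀ O.stationaryState with hp
  have hfix : O.walk O.stationaryState = O.stationaryState :=
    walk_apply_of_mem O.stationaryState_mem_rightSpace (O.stationaryState_mem_leftSpace hpos)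
  have hzero : ∀ k, k ≠ k₀ → slice k p = 0 := fun k hk => slice_embed_of_ne hk _
  have hmix : circuitIso O M (walkPowers pw N) (gateIso O M (.work (mixer k₀ R)) p) =
      gateIso O M (.work (mixer k₀ R)) p := by
    refine ext_slice fun k => ?_
    rw [slice_walkPowers]
    by_cases hk : k ∈ insert k₀ R
    · rw [slice_gateIso_mixer_of_mem O M hk (fun k _ => hzero k), hp, slice_embed_self, map_smul,
        pow_apply_of_fixed hfix]
    · rw [slice_gateIso_mixer_of_notMem O M hk,
        hzero k fun h => hk (h ▸ Finset.mem_insert_self _ _), map_zero]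
  rw [circuitIso_average]
  change gateIso O M (.work (mixer k₀ R)) (circuitIso O M (walkPowers pw N)
    (gateIso O M (.work (mixer k₀ R)) p)) = p
  rw [hmix]
  exact congrArg (fun U => U p) (gateIso_mixer_mul_self O M k₀ R)

theorem approxReflection_apply_stationaryState (hpos : ∀ x, 0 < pi x) :
    circuitIso O M (approxReflection k₀ R pw N) (embed k₀ O.stationaryState) =
      -embed k₀ O.stationaryState := by
  have hV := average_apply_stationaryState O M (k₀ := k₀) (R := R) (pw := pw) (N := N) hpos
  set V := circuitIso O M (average k₀ R pw N)
  set p : EuclideanSpace ℂ (Edge d × K) := embed k₀ O.stationaryState with hp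
  have hV' : V⁻¹ p = p := by
    conv_lhs => rw [← hV]
    exact V.symm_apply_apply p
  rw [circuitIso_approxReflection]
  change V⁻¹ (circuitIso O M (reflectRight {k₀}) (V p)) = _
  rw [hV, reflectRight_singleton_apply]
  have h1 : slice k₀ p = O.stationaryState := slice_embed_self _ _
  rw [h1, Submodule.starProjection_eq_self_iff.2 O.stationaryState_mem_rightSpace, ← hp, map_sub,
    map_smul, hV']
  module

end ApproximateReflection

/-! ### The projection to marked states and the check -/

section Marked

variable {X D : Type*} [Fintype X] [DecidableEq X] {K : Type} [Fintype K] [DecidableEq K]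
  {d : X → D} {zero : X} {P : Matrix X X ℝ} {pi : X → ℝ}

variable (d) in
/-- The projection to the states with a marked first register and the workspace state `k₀`. -/
def markedMap (M : Finset X) (k₀ : K) :
    EuclideanSpace ℂ (Edge d × K) →ₗ[ℂ] EuclideanSpace ℂ (Edge d × K) :=
  embed k₀ ∘ₗ (markedSubspace d M).starProjection.toLinearMap ∘ₗ slice k₀

theorem markedMap_apply (M : Finset X) (k₀ : K) (ψ : EuclideanSpace ℂ (Edge d × K)) :
    markedMap d M k₀ ψ = embed k₀ ((markedSubspace d M).starProjection (slice k₀ ψ)) := rfl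

theorem markedMap_idem (M : Finset X) (k₀ : K) (ψ : EuclideanSpace ℂ (Edge d × K)) :
    markedMap d M k₀ (markedMap d M k₀ ψ) = markedMap d M k₀ ψ := by
  rw [markedMap_apply, markedMap_apply, slice_embed_self,
    Submodule.starProjection_eq_self_iff.2 (Submodule.starProjection_apply_mem _ _)]

theorem markedMap_isSymmetric (M : Finset X) (k₀ : K) : (markedMap d M k₀).IsSymmetric := by
  intro ψ φ
  rw [markedMap_apply, markedMap_apply, inner_embed_left, ← inner_conj_symm ψ, inner_embed_left,
    inner_conj_symm, Submodule.inner_starProjection_left_eq_right]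

theorem check_apply (O : UpdateOracle d zero P pi) (M : Finset X) (k₀ : K)
    (ψ : EuclideanSpace ℂ (Edge d × K)) :
    gateIso O M (.check {k₀}) ψ = ψ - (2 : ℂ) • markedMap d M k₀ ψ := by
  refine ext_slice fun k => ?_
  rw [slice_gateIso_check, map_sub, map_smul, markedMap_apply]
  by_cases hk : k = k₀
  · rw [if_pos (Finset.mem_singleton.2 hk), hk, slice_embed_self, Submodule.reflection_apply,
      neg_sub, two_smul, two_smul]
  · rw [if_neg (fun h => hk (Finset.mem_singleton.1 h)), slice_embed_of_ne hk, smul_zero, sub_zero]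

theorem check_inv (O : UpdateOracle d zero P pi) (M : Finset X) (T : Finset K) :
    (gateIso O M (.check T))⁻¹ = gateIso O M (.check T) := by
  refine inv_eq_of_mul_eq_one_left ?_
  refine LinearIsometryEquiv.ext fun ψ => ext_slice fun k => ?_
  change slice k (gateIso O M (.check T) (gateIso O M (.check T) ψ)) = _
  rw [slice_gateIso_check, slice_gateIso_check]
  split_ifs
  · rw [map_neg, Submodule.reflection_reflection, neg_neg]; rfl
  · rfl

theorem isTrivialOn_check (O : UpdateOracle d zero P pi) (M : Finset X) (T : Finset K) :
    IsTrivialOn {k | k ∉ T} (gateIso O M (.check T)) := fun ψ k hk => by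
  rw [slice_gateIso_check, if_neg hk]

end Marked

/-! ### Recursive amplification and the collection of marked parts in flags -/

section Amplify

open scoped InnerProductSpace

variable {X D : Type*} [Fintype X] [DecidableEq X] {K : Type} [Fintype K] [DecidableEq K]
  {d : X → D} {zero : X} {P : Matrix X X ℝ} {pi : X → ℝ}

/-- Recursive amplitude amplification (`false`) and its inverse (`true`). Level `i + 1` uses the
approximate reflection over the clock `R i`. -/
def amplify (k₀ : K) (R : ℕ → Finset K) (pw : ℕ → K → ℕ) (N : ℕ → ℕ) :
    Bool → ℕ → List (Instr K)
  | _, 0 => []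
  | false, i + 1 => amplify k₀ R pw N false i ++ [.check {k₀}] ++ amplify k₀ R pw N true i ++
      approxReflection k₀ (R i) (pw i) (N i) ++ amplify k₀ R pw N false i
  | true, i + 1 => amplify k₀ R pw N true i ++ approxReflection k₀ (R i) (pw i) (N i) ++
      amplify k₀ R pw N false i ++ [.check {k₀}] ++ amplify k₀ R pw N true i

/-- Moves the marked part at `k₀` to `f`, if nothing is at `f`. -/
def moveMarked (k₀ f : K) : List (Instr K) :=
  [.work (mixer k₀ {f}), .check {f}, .work (mixer k₀ {f})]

/-- Level `2 * l` of the amplification, moving the marked part to `f l`, and back. -/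
def stage (k₀ : K) (R : ℕ → Finset K) (pw : ℕ → K → ℕ) (N : ℕ → ℕ) (f : ℕ → K) (l : ℕ) :
    List (Instr K) :=
  amplify k₀ R pw N false (2 * l) ++ moveMarked k₀ (f l) ++ amplify k₀ R pw N true (2 * l)

variable (O : UpdateOracle d zero P pi) (M : Finset X) (k₀ : K) (R : ℕ → Finset K)
  (pw : ℕ → K → ℕ) (N : ℕ → ℕ)

theorem circuitIso_amplify_true (i : ℕ) : circuitIso O M (amplify k₀ R pw N true i) =
    (circuitIso O M (amplify k₀ R pw N false i))⁻¹ := by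
  induction i with
  | zero => exact inv_one.symm
  | succ i ih =>
    simp only [amplify, circuitIso_append, circuitIso_singleton, ih, mul_inv_rev, inv_inv,
      check_inv, circuitIso_approxReflection_inv, mul_assoc]

theorem circuitIso_amplify_succ_apply (i : ℕ) (ψ : EuclideanSpace ℂ (Edge d × K)) :
    circuitIso O M (amplify k₀ R pw N false (i + 1)) ψ =
      circuitIso O M (amplify k₀ R pw N false i)
        (circuitIso O M (approxReflection k₀ (R i) (pw i) (N i))
          ((circuitIso O M (amplify k₀ R pw N false i))⁻¹
            (circuitIso O M (amplify k₀ R pw N false i) ψ - (2 : ℂ) •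
              markedMap d M k₀ (circuitIso O M (amplify k₀ R pw N false i) ψ)))) := by
  rw [← check_apply O, ← circuitIso_amplify_true, ← circuitIso_singleton,
    ← circuitIso_append_apply, ← circuitIso_append_apply, ← circuitIso_append_apply,
    ← circuitIso_append_apply]
  simp only [amplify, List.append_assoc]

variable {k₀ R pw N}

/-- Used twice: with Z the clock of the next level, which is thereby still empty, and with Z the
flags, which thereby keep their contents. -/
theorem isTrivialOn_amplify {Z : Set K} (hk₀ : k₀ ∉ Z) {i : ℕ}
    (hclock : ∀ j < i, IsClock k₀ (R j) (pw j) (N j)) (hZ : ∀ j < i, ∀ k ∈ Z, k ∉ R j) :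
    IsTrivialOn Z (circuitIso O M (amplify k₀ R pw N false i)) := by
  induction i with
  | zero => exact IsTrivialOn.one
  | succ i ih =>
    have ih' := ih (fun j hj => hclock j (by omega)) (fun j hj => hZ j (by omega))
    have h1 : IsTrivialOn Z (gateIso O M (.check {k₀})) := fun ψ k hk =>
      isTrivialOn_check O M {k₀} ψ k fun h => hk₀ (Finset.mem_singleton.1 h ▸ hk)
    have h2 : IsTrivialOn Z (circuitIso O M (approxReflection k₀ (R i) (pw i) (N i))) :=
      fun ψ k hk => isTrivialOn_approxReflection O M (hclock i (by omega)) ψ k fun h =>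
        (Finset.mem_insert.1 h).elim (fun h => hk₀ (h ▸ hk)) (hZ i (by omega) k hk)
    simp only [amplify, circuitIso_append, circuitIso_singleton, circuitIso_amplify_true]
    exact ih'.mul (h2.mul (ih'.inv.mul (h1.mul ih')))

/-- The approximate reflections need not return their clocks to the start, so each level gets a
clock disjoint from the earlier ones. The levels below i do not touch R i, hence the vector to be
reflected has nothing there. -/
theorem norm_markedMap_amplify_sub_le {δ : ℝ}
    (hP : P ∈ Matrix.rowStochastic ℝ X) (hpi : IsStationaryDistribution P pi)
    (hpos : ∀ x, 0 < pi x) (hgap : singularValueGap (discriminant P pi) = δ) (hδ : 0 < δ) {i : ℕ}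
    (hclock : ∀ j < i + 1, IsClock k₀ (R j) (pw j) (N j))
    (hdisj : ∀ j < i, Disjoint (R j) (R i)) (hk₀ : k₀ ∉ R i)
    (hN : 2 ^ (i + 4) ≤ N i * √δ) :
    ‖markedMap d M k₀
          (circuitIso O M (amplify k₀ R pw N false (i + 1)) (embed k₀ O.stationaryState)) -
        (4 * ‖markedMap d M k₀
          (circuitIso O M (amplify k₀ R pw N false i) (embed k₀ O.stationaryState))‖ ^ 2 - 3 : ℂ) •
          markedMap d M k₀
            (circuitIso O M (amplify k₀ R pw N false i) (embed k₀ O.stationaryState))‖ ≤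
      (1 / 2) ^ (i + 2) * ‖markedMap d M k₀
        (circuitIso O M (amplify k₀ R pw N false i) (embed k₀ O.stationaryState))‖ := by
  set U := circuitIso O M (amplify k₀ R pw N false i) with hU
  have htriv : IsTrivialOn (R i : Set K) U := isTrivialOn_amplify O M (by simpa using hk₀)
    (fun j hj => hclock j (by omega))
    (fun j hj k hk h => Finset.disjoint_left.1 (hdisj j hj) h hk)
  rw [circuitIso_amplify_succ_apply, ← hU]
  refine (norm_amplification_sub_le (markedMap_isSymmetric M k₀) (markedMap_idem M k₀)
    (by rw [norm_embed, O.norm_stationaryState hpi]) U _ (β := (1 / 2) ^ (i + 3))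
    (by positivity) (approxReflection_apply_stationaryState O M hpos) ?_).trans_eq
    (by rw [pow_succ _ (i + 2)]; ring)
  intro q hpq hq
  refine norm_approxReflection_sub_le O M hP hpi hpos hgap hδ (hclock i (by omega)) ?_ ?_ ?_ ?_
  -- The reflection error 2/(N√δ) must be at most 2^-(i+3), since amplification doubles it.
  · calc (2 : ℝ) = (1 / 2) ^ (i + 3) * 2 ^ (i + 4) := by
          rw [one_div, inv_pow, pow_succ _ (i + 3)]; field_simp
      _ ≤ _ := by gcongr
  · rcases Nat.eq_zero_or_pos (N i) with h | h
    · rw [h] at hN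
      have : (0 : ℝ) < 2 ^ (i + 4) := by positivity
      simp at hN; linarith
    · exact h
  · intro k hk hne
    rw [hq, map_sub, map_smul, htriv.inv _ k hk, markedMap_apply, slice_embed_of_ne hne,
      slice_embed_of_ne hne, smul_zero, sub_zero]
  · rw [← inner_embed_left, hpq]

/-- Interference: the mixer puts equal copies of h at k₀ and f, the check turns the copy at f into h
- 2g with g the marked part, and the second mixer recombines them to h - g at k₀ and g at f. -/
theorem slice_moveMarked {f : K} (hf : f ≠ k₀) {φ : EuclideanSpace ℂ (Edge d × K)}
    (hφ : slice f φ = 0) (k : K) :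
    slice k (circuitIso O M (moveMarked k₀ f) φ) =
      if k = k₀ then slice k₀ φ - (markedSubspace d M).starProjection (slice k₀ φ)
      else if k = f then (markedSubspace d M).starProjection (slice k₀ φ)
      else slice k φ := by
  set s := uniformAmplitude k₀ {f} with hs
  set h := slice k₀ φ with hh
  set g := (markedSubspace d M).starProjection h with hg
  have hss : s ^ 2 * 2 = 1 := by
    have := uniformAmplitude_sq k₀ {f}
    rwa [Finset.card_pair hf.symm, Nat.cast_ofNat] at this
  have hs1 : 1 - s ≠ 0 := by
    intro h0
    have : s = 1 := (sub_eq_zero.1 h0).symm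
    rw [this] at hss; norm_num at hss
  set φ₁ := gateIso O M (.work (mixer k₀ {f})) φ with hφ₁
  set φ₂ := gateIso O M (.check {f}) φ₁ with hφ₂
  have hz : ∀ k ∈ ({f} : Finset K), k ≠ k₀ → slice k φ = 0 := fun k hk _ => by
    rw [Finset.mem_singleton.1 hk, hφ]
  have e1 : slice k₀ φ₁ = s • h := slice_gateIso_mixer_of_mem O M (by simp) hz
  have e2 : slice f φ₁ = s • h := slice_gateIso_mixer_of_mem O M (by simp) hz
  have e3 : slice k₀ φ₂ = s • h := by
    rw [hφ₂, slice_gateIso_check, if_neg (by simpa using hf.symm), e1]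
  have e4 : slice f φ₂ = s • h - (2 * s) • g := by
    rw [hφ₂, slice_gateIso_check, if_pos (by simp), e2, map_smul, Submodule.reflection_apply, ← hg]
    module
  have hsum : ∑ k ∈ insert k₀ {f}, slice k φ₂ = (2 * s) • h - (2 * s) • g := by
    rw [Finset.sum_pair hf.symm, e3, e4]
    module
  change slice k (gateIso O M (.work (mixer k₀ {f})) φ₂) = _
  by_cases hk : k = k₀
  · rw [if_pos hk, hk, slice_gateIso_mixer_self, hsum, ← hs, smul_sub, smul_smul,
      smul_smul, show s * (2 * s) = 1 by linear_combination hss, one_smul, one_smul]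
  · rw [if_neg hk]
    by_cases hkf : k = f
    · rw [if_pos hkf, hkf, slice_gateIso_mixer, hsum, ← hs,
        mixerVec_of_mem (Finset.mem_singleton_self f) hf, ← hs, e3, e4]
      have h1 : s • ((2 * s) • h - (2 * s) • g) = h - g := by
        rw [smul_sub, smul_smul, smul_smul, show s * (2 * s) = 1 by linear_combination hss,
          one_smul, one_smul]
      rw [h1]
      have h2 : s • h - (h - g) = g - (1 - s) • h := by module
      rw [h2, smul_sub, smul_smul, mul_right_comm, inv_mul_cancel₀ hs1]
      have h3 : s • h - (2 * s) • g - (((1 - s)⁻¹ * -s) • g - (1 * -s) • h) =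
          (-(2 * s) + (1 - s)⁻¹ * s) • g := by module
      rw [h3]
      have h4 : -(2 * s) + (1 - s)⁻¹ * s = 1 := by
        field_simp
        linear_combination hss
      rw [h4, one_smul]
    · have hk' : k ∉ (insert k₀ {f} : Finset K) := by simp [hk, hkf]
      rw [if_neg hkf, slice_gateIso_mixer_of_notMem O M hk', hφ₂, slice_gateIso_check,
        if_neg (by simpa using hkf), hφ₁, slice_gateIso_mixer_of_notMem O M hk']

variable (k₀ R pw N) in
/-- The part of the state that has not been found to be marked before stage `n`. -/
def unfound : ℕ → EuclideanSpace ℂ (Edge d × K)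
  | 0 => embed k₀ O.stationaryState
  | l + 1 => unfound l - (circuitIso O M (amplify k₀ R pw N false (2 * l)))⁻¹
      (markedMap d M k₀ (circuitIso O M (amplify k₀ R pw N false (2 * l)) (unfound l)))

/-- Off the flags the state equals the unfound vector, so their difference lives on the flags and is
fixed by every amplification circuit. The emptiness of later flags is carried along because
`slice_moveMarked` needs it. -/
theorem slice_stages {f : ℕ → K} {L : ℕ}
    (hclock : ∀ j < 2 * L, IsClock k₀ (R j) (pw j) (N j))
    (hf : Set.InjOn f {l | l ≤ L}) (hfk : ∀ l ≤ L, f l ≠ k₀)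
    (hfR : ∀ l ≤ L, ∀ j < 2 * L, f l ∉ R j) {n : ℕ} (hn : n ≤ L + 1) :
    (∀ k ∉ f '' {l | l ≤ L},
      slice k (circuitIso O M ((List.range n).flatMap (stage k₀ R pw N f))
        (embed k₀ O.stationaryState) - unfound O M k₀ R pw N n) = 0) ∧
    (∀ j ≤ L, n ≤ j → slice (f j) (circuitIso O M ((List.range n).flatMap (stage k₀ R pw N f))
        (embed k₀ O.stationaryState)) = 0) ∧
    (∀ j < n, slice (f j) (circuitIso O M ((List.range n).flatMap (stage k₀ R pw N f))
        (embed k₀ O.stationaryState)) =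
      slice k₀ (markedMap d M k₀ (circuitIso O M (amplify k₀ R pw N false (2 * j))
        (unfound O M k₀ R pw N j)))) := by
  induction n with
  | zero =>
    refine ⟨fun k _ => ?_, fun j hj _ => slice_embed_of_ne (hfk j hj) _, fun j hj => by omega⟩
    rw [show circuitIso O M ((List.range 0).flatMap (stage k₀ R pw N f))
      (embed k₀ O.stationaryState) = embed k₀ O.stationaryState from rfl, unfound, sub_self,
      map_zero]
  | succ n ih =>
    obtain ⟨iha, ihb, ihc⟩ := ih (by omega)
    have hnL : n ≤ L := by omega
    set Fl := f '' {l | l ≤ L} with hFl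
    set Ψ := circuitIso O M ((List.range n).flatMap (stage k₀ R pw N f))
      (embed k₀ O.stationaryState) with hΨ
    set v := unfound O M k₀ R pw N n with hv
    set U := circuitIso O M (amplify k₀ R pw N false (2 * n)) with hU
    have hk₀ : k₀ ∉ Fl := by
      rintro ⟨l, hl, h⟩
      exact hfk l hl h
    have htriv : IsTrivialOn Fl U := by
      refine isTrivialOn_amplify O M hk₀ (fun j hj => hclock j (by omega)) ?_
      rintro j hj _ ⟨l, hl, rfl⟩
      exact hfR l hl j (by omega)
    have hstep : circuitIso O M ((List.range (n + 1)).flatMap (stage k₀ R pw N f))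
        (embed k₀ O.stationaryState) = U⁻¹ (circuitIso O M (moveMarked k₀ (f n)) (U Ψ)) := by
      rw [List.range_succ, List.flatMap_append, List.flatMap_singleton, circuitIso_append_apply,
        ← hΨ, stage, circuitIso_append_apply, circuitIso_append_apply, circuitIso_amplify_true]
    have hUD : U (Ψ - v) = Ψ - v := htriv.apply_eq_self iha
    have hUΨ : U Ψ = U v + (Ψ - v) := by rw [← hUD, map_sub]; abel
    have hfn : slice (f n) (U Ψ) = 0 := by
      rw [htriv Ψ _ ⟨n, hnL, rfl⟩]; exact ihb n hnL le_rfl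
    have hsl : ∀ k ∉ Fl, slice k (U Ψ) = slice k (U v) := fun k hk => by
      rw [hUΨ, map_add, iha k hk, add_zero]
    have hmove := slice_moveMarked O M (hfk n hnL) hfn
    set Φ := circuitIso O M (moveMarked k₀ (f n)) (U Ψ) with hΦ
    have hv' : unfound O M k₀ R pw N (n + 1) = U⁻¹ (U v - markedMap d M k₀ (U v)) := by
      rw [unfound, ← hv, ← hU, map_sub]
      congr 1
      exact (U.symm_apply_apply v).symm
    have hD : ∀ k ∉ Fl, slice k (Φ - (U v - markedMap d M k₀ (U v))) = 0 := by
      intro k hk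
      have hkn : k ≠ f n := fun h => hk (h ▸ ⟨n, hnL, rfl⟩)
      rw [map_sub, map_sub, hmove, markedMap_apply]
      by_cases hkk : k = k₀
      · rw [if_pos hkk, hkk, slice_embed_self, hsl k₀ hk₀, sub_self]
      · rw [if_neg hkk, if_neg hkn, slice_embed_of_ne hkk, hsl k hk, sub_zero, sub_self]
    have hfinal : ∀ j ≤ L, slice (f j) (U⁻¹ Φ) = if j = n then
        slice k₀ (markedMap d M k₀ (U v)) else slice (f j) Ψ := by
      intro j hj
      rw [htriv.inv _ _ ⟨j, hj, rfl⟩, hmove, if_neg (hfk j hj)]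
      by_cases hjn : j = n
      · rw [if_pos hjn, if_pos (by rw [hjn]), markedMap_apply, slice_embed_self, hsl k₀ hk₀]
      · rw [if_neg hjn, if_neg (fun h => hjn (hf hj hnL h)), htriv Ψ _ ⟨j, hj, rfl⟩]
    rw [hstep]
    refine ⟨fun k hk => ?_, fun j hj hnj => ?_, fun j hj => ?_⟩
    · rw [hv', ← map_sub, htriv.inv.apply_eq_self hD]
      exact hD k hk
    · rw [hfinal j hj, if_neg (by omega), ihb j hj (by omega)]
    · rw [hfinal j (by omega)]
      by_cases hjn : j = n
      · rw [if_pos hjn, hjn]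
      · rw [if_neg hjn, ihc j (by omega)]

end Amplify

/-! ### Cost of the circuits -/

section Cost

variable {K : Type} [Fintype K] [DecidableEq K]

/-- The total cost of a list of instructions. -/
def circuitCost (U C : ℝ) (c : List (Instr K)) : ℝ := (c.map (Instr.cost U C)).sum

variable (U C : ℝ)

theorem circuitCost_append (c c' : List (Instr K)) :
    circuitCost U C (c ++ c') = circuitCost U C c + circuitCost U C c' := by
  rw [circuitCost, List.map_append, List.sum_append]; rfl

theorem circuitCost_reflectRight (T : Finset K) : circuitCost U C (reflectRight T) = 2 * U := by
  simp [circuitCost, reflectRight, Instr.cost]; ring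

theorem circuitCost_reflectLeft (T : Finset K) : circuitCost U C (reflectLeft T) = 2 * U := by
  simp [circuitCost, reflectLeft, Instr.cost]; ring

theorem circuitCost_flatMap_range_const {c : ℕ → List (Instr K)} {a : ℝ}
    (h : ∀ m, circuitCost U C (c m) = a) (N : ℕ) :
    circuitCost U C ((List.range N).flatMap c) = N * a := by
  induction N with
  | zero => simp [circuitCost]
  | succ N ih =>
    rw [List.range_succ, List.flatMap_append, List.flatMap_singleton, circuitCost_append, ih, h]
    push_cast; ring

theorem circuitCost_work (V : Matrix.unitaryGroup K ℂ) :
    circuitCost U C ([.work V] : List (Instr K)) = 0 := by simp [circuitCost, Instr.cost]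

theorem circuitCost_approxReflection (k₀ : K) (R : Finset K) (pw : K → ℕ) (N : ℕ) :
    circuitCost U C (approxReflection k₀ R pw N) = (8 * N + 2) * U := by
  have h1 : circuitCost U C (walkPowers pw N) = N * (4 * U) :=
    circuitCost_flatMap_range_const U C (fun m => by
      rw [circuitCost_append, circuitCost_reflectLeft, circuitCost_reflectRight]; ring) N
  have h2 : circuitCost U C (walkPowersInv pw N) = N * (4 * U) :=
    circuitCost_flatMap_range_const U C (fun m => by
      rw [circuitCost_append, circuitCost_reflectLeft, circuitCost_reflectRight]; ring) N
  simp only [approxReflection, average, averageInv, circuitCost_append, circuitCost_work, h1, h2,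
    circuitCost_reflectRight]
  ring

theorem circuitCost_check (T : Finset K) :
    circuitCost U C ([.check T] : List (Instr K)) = C := by simp [circuitCost, Instr.cost]

variable {U C}

/-- A level consists of three copies of the previous one and at most 10·2^i N₀U + C more. The
subtracted term closes the induction, as 30·2^i - 10·2^i = 10·2^(i+1) and 3/2 - 1 = 1/2. -/
theorem circuitCost_amplify_le (hU : 0 ≤ U) (hC : 0 ≤ C) {N₀ : ℕ} (hN₀ : 1 ≤ N₀) (k₀ : K)
    (R : ℕ → Finset K) (pw : ℕ → K → ℕ) (i : ℕ) : ∀ b : Bool,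
    circuitCost U C (amplify k₀ R pw (fun i => 2 ^ i * N₀) b i) ≤
      3 ^ i * (10 * N₀ * U + C) - (10 * N₀ * 2 ^ i * U + C / 2) := by
  induction i with
  | zero =>
    intro b
    simp [amplify, circuitCost]
    linarith
  | succ i ih =>
    have h0 := ih false
    have h1 := ih true
    have h2 : (1 : ℝ) ≤ N₀ * 2 ^ i := by
      have : (1 : ℝ) ≤ N₀ := by exact_mod_cast hN₀
      exact one_le_mul_of_one_le_of_one_le this (one_le_pow₀ (by norm_num))
    have h3 : U ≤ N₀ * 2 ^ i * U := le_mul_of_one_le_left hU h2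
    intro b
    cases b <;>
    · simp only [amplify, circuitCost_append, circuitCost_check, circuitCost_approxReflection]
      rw [pow_succ, pow_succ]
      push_cast
      nlinarith

theorem circuitCost_stage_le (hU : 0 ≤ U) (hC : 0 ≤ C) {N₀ : ℕ} (hN₀ : 1 ≤ N₀) (k₀ : K)
    (R : ℕ → Finset K) (pw : ℕ → K → ℕ) (f : ℕ → K) (l : ℕ) :
    circuitCost U C (stage k₀ R pw (fun i => 2 ^ i * N₀) f l) ≤
      9 ^ l * (20 * N₀ * U + 2 * C) := by
  have h0 := circuitCost_amplify_le hU hC hN₀ k₀ R pw (2 * l) false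
  have h1 := circuitCost_amplify_le hU hC hN₀ k₀ R pw (2 * l) true
  have h2 : circuitCost U C (moveMarked k₀ (f l)) = C := by
    simp [circuitCost, moveMarked, Instr.cost]
  have h3 : 0 ≤ 10 * N₀ * 2 ^ (2 * l) * U := by positivity
  rw [stage, circuitCost_append, circuitCost_append, h2]
  rw [pow_mul (3 : ℝ)] at h0 h1
  norm_num at h0 h1
  linarith

theorem circuitCost_stages_le (hU : 0 ≤ U) (hC : 0 ≤ C) {N₀ : ℕ} (hN₀ : 1 ≤ N₀) (k₀ : K)
    (R : ℕ → Finset K) (pw : ℕ → K → ℕ) (f : ℕ → K) (n : ℕ) :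
    circuitCost U C ((List.range n).flatMap (stage k₀ R pw (fun i => 2 ^ i * N₀) f)) ≤
      9 ^ n / 8 * (20 * N₀ * U + 2 * C) := by
  induction n with
  | zero =>
    have : 0 ≤ 9 ^ 0 / 8 * (20 * N₀ * U + 2 * C) := by positivity
    simpa [circuitCost] using this
  | succ n ih =>
    have := circuitCost_stage_le hU hC hN₀ k₀ R pw f n
    rw [List.range_succ, List.flatMap_append, List.flatMap_singleton, circuitCost_append, pow_succ]
    linarith

end Cost

/-! ### The workspace and one run of the search -/

section SearchRun

/-- The workspace: the start `none`, the clocks, and the flags. -/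
abbrev Workspace (a b c : ℕ) : Type := Option ((Fin a × Fin b) ⊕ Fin c)

variable {a b c : ℕ}

/-- The position of a workspace state in the clock `i` of length `n`. -/
def clockPosition (n i : ℕ) : Workspace a b c → ℕ
  | some (.inl (j, m)) => if j.val = i ∧ m.val + 1 < n then m.val + 1 else 0
  | _ => 0

/-- The states of the clock `i` of length `n`, without the start. -/
def clockStates (n i : ℕ) : Finset (Workspace a b c) :=
  Finset.univ.filter fun k => clockPosition n i k ≠ 0

theorem exists_of_clockPosition_ne_zero {n i : ℕ} {k : Workspace a b c}
    (h : clockPosition n i k ≠ 0) : ∃ (j : Fin a) (m : Fin b), k = some (.inl (j, m)) ∧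
      j.val = i ∧ clockPosition n i k = m.val + 1 := by
  match k, h with
  | some (.inl (j, m)), h =>
    refine ⟨j, m, rfl, ?_⟩
    simp only [clockPosition] at h ⊢
    split_ifs at h ⊢ with h1
    · exact ⟨h1.1, rfl⟩
    · exact absurd rfl h

/-- The common start `none` is position 0 of every clock, which is why the private states of a clock
begin at position 1. -/
theorem isClock_clockStates {n i : ℕ} (hn : 1 ≤ n) (hi : i < a) (hb : n ≤ b) :
    IsClock (none : Workspace a b c) (clockStates n i) (clockPosition n i) n where
  injOn := by
    have key : ∀ k : Workspace a b c, k ∈ insert none (clockStates n i) →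
        clockPosition n i k = 0 → k = none := fun k hk h0 =>
      (Finset.mem_insert.1 hk).resolve_right fun h => (Finset.mem_filter.1 h).2 h0
    intro k hk k' hk' h
    by_cases h0 : clockPosition n i k = 0
    · rw [key k hk h0, key k' hk' (h ▸ h0)]
    · obtain ⟨j, m, rfl, hj, hm⟩ := exists_of_clockPosition_ne_zero h0
      obtain ⟨j', m', rfl, hj', hm'⟩ := exists_of_clockPosition_ne_zero (h ▸ h0)
      have e1 : j = j' := Fin.ext (hj.trans hj'.symm)
      have e2 : m = m' := Fin.ext (by omega)
      rw [e1, e2]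
  image_eq := by
    ext t
    rw [Finset.mem_image, Finset.mem_range]
    constructor
    · rintro ⟨k, -, rfl⟩
      match k with
      | some (.inl (j, m)) => simp only [clockPosition]; split_ifs <;> omega
      | some (.inr _) => exact hn
      | none => exact hn
    · intro ht
      rcases t with _ | t
      · exact ⟨none, Finset.mem_insert_self _ _, rfl⟩
      · have h : clockPosition n i
            (some (.inl (⟨i, hi⟩, ⟨t, by omega⟩)) : Workspace a b c) = t + 1 := by
          simp [clockPosition, ht]
        refine ⟨some (.inl (⟨i, hi⟩, ⟨t, by omega⟩)), Finset.mem_insert_of_mem ?_, h⟩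
        rw [clockStates, Finset.mem_filter, h]
        exact ⟨Finset.mem_univ _, by omega⟩
  eq_zero k hk := by
    by_contra h
    exact hk (Finset.mem_insert_of_mem (Finset.mem_filter.2 ⟨Finset.mem_univ _, h⟩))

theorem none_notMem_clockStates (n i : ℕ) : (none : Workspace a b c) ∉ clockStates n i :=
  fun h => (Finset.mem_filter.1 h).2 rfl

theorem inr_notMem_clockStates (n i : ℕ) (l : Fin c) :
    (some (.inr l) : Workspace a b c) ∉ clockStates n i :=
  fun h => (Finset.mem_filter.1 h).2 rfl

theorem disjoint_clockStates {n n' i j : ℕ} (hij : i ≠ j) :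
    Disjoint (clockStates n i : Finset (Workspace a b c)) (clockStates n' j) := by
  rw [Finset.disjoint_left]
  intro k hk hk'
  obtain ⟨m, _, h, hm, -⟩ := exists_of_clockPosition_ne_zero (Finset.mem_filter.1 hk).2
  obtain ⟨m', _, h', hm', -⟩ := exists_of_clockPosition_ne_zero (Finset.mem_filter.1 hk').2
  rw [h] at h'
  simp only [Option.some.injEq, Sum.inl.injEq, Prod.mk.injEq] at h'
  exact hij (by rw [← hm, ← hm', h'.1])

/-- The flag of stage `l`. -/
def flag (a b L l : ℕ) : Workspace a b (L + 1) := some (.inr (Fin.ofNat (L + 1) l))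

/-- `Fin.ofNat` reduces modulo L + 1, without effect for l ≤ L. -/
theorem flag_injOn (a b L : ℕ) : Set.InjOn (flag a b L) {l | l ≤ L} := by
  intro l hl l' hl' h
  simp only [flag, Option.some.injEq, Sum.inr.injEq, Fin.ext_iff, Fin.val_ofNat] at h
  simp only [Set.mem_ofPred_eq] at hl hl'
  rwa [Nat.mod_eq_of_lt (by omega), Nat.mod_eq_of_lt (by omega)] at h

/-- One run of the search: the stages `0, …, L`, with clocks of lengths `2 ^ i * N₀`. -/
def searchRun (L N₀ : ℕ) : Run where
  K := Workspace (2 * L) (2 ^ (2 * L) * N₀) (L + 1)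
  init := none
  instrs := [.updateRight] ++ (List.range (L + 1)).flatMap
    (stage none (fun i => clockStates (2 ^ i * N₀) i) (fun i => clockPosition (2 ^ i * N₀) i)
      (fun i => 2 ^ i * N₀) (flag _ _ L))

theorem cost_searchRun_le {S U C : ℝ} (hU : 0 ≤ U) (hC : 0 ≤ C) {L N₀ : ℕ} (hN₀ : 1 ≤ N₀) :
    (searchRun L N₀).cost S U C ≤ S + U + 9 ^ (L + 1) / 8 * (20 * N₀ * U + 2 * C) + C := by
  have h := circuitCost_stages_le hU hC hN₀ (none : (searchRun L N₀).K)
    (fun i => clockStates (2 ^ i * N₀) i) (fun i => clockPosition (2 ^ i * N₀) i) (flag _ _ L)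
    (L + 1)
  have h2 : (searchRun L N₀).cost S U C = S + circuitCost U C (searchRun L N₀).instrs + C := rfl
  have h3 : circuitCost U C ([.updateRight] : List (Instr (searchRun L N₀).K)) = U := by
    simp [circuitCost, Instr.cost]
  rw [h2, searchRun, circuitCost_append]
  change S + (circuitCost U C ([.updateRight] : List (Instr (searchRun L N₀).K)) + _) + C ≤ _
  rw [h3]
  linarith!

end SearchRun

/-! ### Success probability of one run -/

section Observation

variable {X D : Type*} [Fintype X] [DecidableEq X] {d : X → D} {zero : X} {P : Matrix X X ℝ}
  {pi : X → ℝ}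

theorem finalState_eq (r : Run) (O : UpdateOracle d zero P pi) (M : Finset X) :
    r.finalState O M = (circuitIso O M r.instrs (embed r.init (setupState d zero pi))).ofLp := by
  rw [ofLp_circuitIso]; rfl

theorem observeProb_nonneg (r : Run) (O : UpdateOracle d zero P pi) (M : Finset X) (x : X) :
    0 ≤ r.observeProb O M x :=
  Finset.sum_nonneg fun _ _ => Finset.sum_nonneg fun _ _ => by positivity

theorem sum_observeProb (r : Run) (O : UpdateOracle d zero P pi)
    (hpi : IsStationaryDistribution P pi) (M : Finset X) : ∑ x, r.observeProb O M x = 1 := by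
  have h : ‖circuitIso O M r.instrs (embed r.init (setupState d zero pi))‖ ^ 2 = 1 := by
    rw [LinearIsometryEquiv.norm_map, norm_embed, norm_sq_setupState hpi]
  rw [← h, EuclideanSpace.norm_sq_eq, Fintype.sum_prod_type, Fintype.sum_prod_type,
    ← Equiv.sum_comp (DataState.equivState d).symm]
  simp only [Run.observeProb, finalState_eq]
  rfl

/-- Observation sums over all workspace states, so a single marked component already bounds the
probability from below. -/
theorem norm_slice_sq_le_sum_observeProb (r : Run) (O : UpdateOracle d zero P pi) (M : Finset X)
    (k : r.K)
    (hk : slice k (circuitIso O M r.instrs (embed r.init (setupState d zero pi))) ∈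
      markedSubspace d M) :
    ‖slice k (circuitIso O M r.instrs (embed r.init (setupState d zero pi)))‖ ^ 2 ≤
      ∑ x ∈ M, r.observeProb O M x := by
  set ψ := circuitIso O M r.instrs (embed r.init (setupState d zero pi)) with hψ
  rw [EuclideanSpace.norm_sq_eq, sum_edge]
  rw [← Finset.sum_subset (Finset.subset_univ M)]
  · refine Finset.sum_le_sum fun x _ => ?_
    rw [Run.observeProb, finalState_eq, ← hψ, ← Equiv.sum_comp (DataState.equivState d).symm]
    refine Finset.sum_le_sum fun y _ => ?_
    exact Finset.single_le_sum
      (f := fun k => ‖ψ ((DataState.of d x, DataState.of d y), k)‖ ^ 2)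
      (fun _ _ => by positivity) (Finset.mem_univ k)
  · intro x _ hx
    refine Finset.sum_eq_zero fun y _ => ?_
    rw [hk (DataState.of d x, DataState.of d y) hx]
    simp

theorem norm_sq_starProjection_stationaryState (O : UpdateOracle d zero P pi)
    (hP : P ∈ Matrix.rowStochastic ℝ X) (hpi : IsStationaryDistribution P pi) (M : Finset X) :
    ‖(markedSubspace d M).starProjection O.stationaryState‖ ^ 2 = ∑ x ∈ M, pi x := by
  rw [markedSubspace, coordinateSubspace_starProjection, EuclideanSpace.norm_sq_eq, sum_edge,
    ← Finset.sum_subset (Finset.subset_univ M)]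
  · refine Finset.sum_congr rfl fun x hx => ?_
    have h : ∀ y, ‖(WithLp.toLp 2 (fun e : Edge d => if e.1.state ∈ M then O.stationaryState e
        else 0) : EuclideanSpace ℂ (Edge d)) (DataState.of d x, DataState.of d y)‖ ^ 2 =
        pi x * P x y := by
      intro y
      have h1 : (DataState.of d x).state ∈ M := hx
      rw [PiLp.toLp_apply, if_pos h1, O.stationaryState_apply, norm_mul, Complex.norm_real,
        Complex.norm_real, mul_pow, Real.norm_eq_abs, Real.norm_eq_abs, sq_abs, sq_abs,
        Real.sq_sqrt (hpi.1.1 x), Real.sq_sqrt (Matrix.nonneg_of_mem_rowStochastic hP)]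
    simp_rw [h]
    rw [← Finset.mul_sum, Matrix.sum_row_of_mem_rowStochastic hP, mul_one]
  · intro x _ hx
    refine Finset.sum_eq_zero fun y _ => ?_
    have h1 : (DataState.of d x).state ∉ M := hx
    rw [PiLp.toLp_apply, if_neg h1]
    simp

theorem sum_observeProb_searchRun_ge (O : UpdateOracle d zero P pi) {δ ε : ℝ}
    (hP : P ∈ Matrix.rowStochastic ℝ X) (hpi : IsStationaryDistribution P pi)
    (hpos : ∀ x, 0 < pi x) (hgap : singularValueGap (discriminant P pi) = δ) (hδ : 0 < δ)
    {M : Finset X} (hε : ε ≤ ∑ x ∈ M, pi x) {L N₀ : ℕ} (hL : 1 ≤ 9 ^ L * √ε)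
    (hN₀ : 16 ≤ N₀ * √δ) :
    (1 / 32) ^ 2 ≤ ∑ x ∈ M, (searchRun L N₀).observeProb O M x := by
  have hN₀' : 1 ≤ N₀ := by
    rcases Nat.eq_zero_or_pos N₀ with h | h
    · rw [h] at hN₀; norm_num at hN₀
    · exact h
  set k₀ : (searchRun L N₀).K := none with hk₀
  set R : ℕ → Finset (searchRun L N₀).K := fun i => clockStates (2 ^ i * N₀) i with hR
  set pw : ℕ → (searchRun L N₀).K → ℕ := fun i => clockPosition (2 ^ i * N₀) i with hpw
  set N : ℕ → ℕ := fun i => 2 ^ i * N₀ with hN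
  have hclock : ∀ j < 2 * L, IsClock k₀ (R j) (pw j) (N j) := fun j hj =>
    isClock_clockStates (Nat.one_le_iff_ne_zero.2 (by positivity)) hj
      (Nat.mul_le_mul_right _ (Nat.pow_le_pow_right (by norm_num) hj.le))
  have hstep : ∀ i < 2 * L, _ := fun i hi =>
    norm_markedMap_amplify_sub_le O M hP hpi hpos hgap hδ (k₀ := k₀) (R := R) (pw := pw) (N := N)
      (i := i) (fun j hj => hclock j (by omega)) (fun j hj => disjoint_clockStates (by omega))
      (none_notMem_clockStates _ _) (by
        rw [hN]; push_cast
        calc (2 : ℝ) ^ (i + 4) = 2 ^ i * 16 := by rw [pow_add]; norm_num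
          _ ≤ 2 ^ i * (N₀ * √δ) := by gcongr
          _ = _ := by ring)
  obtain ⟨l, hl, hge⟩ := exists_norm_marked_ge (markedMap_isSymmetric M k₀)
    (markedMap_idem (d := d) M k₀) (fun i => circuitIso O M (amplify k₀ R pw N false i)) (L := L)
    (p := embed k₀ O.stationaryState) (fun i hi => hstep i hi)
    (by rw [norm_embed, O.norm_stationaryState hpi])
    (by
      -- At level 0 the marked amplitude is the square root of the stationary mass of M, at least
      -- √ε.
      refine hL.trans ?_
      gcongr
      refine Real.sqrt_le_iff.2 ⟨norm_nonneg _, ?_⟩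
      change ε ≤ ‖markedMap d M k₀ (embed k₀ O.stationaryState)‖ ^ 2
      rw [markedMap_apply, norm_embed, slice_embed_self,
        norm_sq_starProjection_stationaryState O hP hpi]
      exact hε)
    (v := unfound O M k₀ R pw N) rfl (fun _ => rfl)
  -- After all L + 1 stages, flag l still holds what stage l moved there.
  have hst := (slice_stages O M (k₀ := k₀) (R := R) (pw := pw) (N := N) (f := flag _ _ L) (L := L)
    hclock (flag_injOn _ _ L) (fun l _ => Option.some_ne_none _)
    (fun l _ j _ => inr_notMem_clockStates _ _ _) le_rfl).2.2 l (by omega)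
  have hfinal : circuitIso O M (searchRun L N₀).instrs
      (embed (searchRun L N₀).init (setupState d zero pi)) =
      circuitIso O M ((List.range (L + 1)).flatMap (stage k₀ R pw N (flag _ _ L)))
        (embed k₀ O.stationaryState) := by
    have h1 : gateIso O M .updateRight (embed k₀ (setupState d zero pi)) =
        embed k₀ O.stationaryState := by
      refine ext_slice fun k => ?_
      rw [slice_gateIso_updateRight, slice_embed, slice_embed]
      split_ifs
      · rfl
      · exact map_zero _
    rw [← h1, ← circuitIso_singleton, ← circuitIso_append_apply]
    rfl
  rw [← hfinal, markedMap_apply, slice_embed_self] at hst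
  rw [markedMap_apply, norm_embed] at hge
  refine le_trans ?_ (norm_slice_sq_le_sum_observeProb (searchRun L N₀) O M (flag _ _ L l) ?_)
  · rw [hst]; gcongr
  · rw [hst]; exact Submodule.starProjection_apply_mem _ _

end Observation

/-! ### Success probability of repeated runs -/

section Success

open SearchAlgorithm

variable {X D : Type*} [Fintype X] [DecidableEq X] {d : X → D} {zero : X} {P : Matrix X X ℝ}
  {pi : X → ℝ}

theorem successProb_empty (alg : SearchAlgorithm) (O : UpdateOracle d zero P pi)
    (hpi : IsStationaryDistribution P pi) : alg.successProb O (∅ : Finset X) = 1 := by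
  have h : outputProb O (∅ : Finset X) alg none = 1 := by
    induction alg with
    | nil => rfl
    | cons r rs ih =>
      rw [outputProb, ih, mul_one, Finset.compl_empty, sum_observeProb r O hpi]
  rw [successProb, Finset.sum_filter, Fintype.sum_option]
  simp [IsCorrect, h]

theorem successProb_of_nonempty (alg : SearchAlgorithm) (O : UpdateOracle d zero P pi)
    {M : Finset X} (hM : M.Nonempty) :
    alg.successProb O M = ∑ x ∈ M, outputProb O M alg (some x) := by
  rw [successProb, Finset.sum_filter, Fintype.sum_option]
  simp only [IsCorrect, hM.ne_empty, if_false, zero_add]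
  trans ∑ x, if x ∈ M then outputProb O M alg (some x) else 0
  · exact Finset.sum_congr rfl fun x _ => by by_cases h : x ∈ M <;> simp [h]
  · rw [Finset.sum_ite_mem, Finset.univ_inter]

theorem sum_outputProb_replicate (r : Run) (O : UpdateOracle d zero P pi)
    (hpi : IsStationaryDistribution P pi) (M : Finset X) (n : ℕ) :
    ∑ x ∈ M, outputProb O M (List.replicate n r) (some x) =
      1 - (1 - ∑ x ∈ M, r.observeProb O M x) ^ n := by
  have hc : ∑ z ∈ Mᶜ, r.observeProb O M z = 1 - ∑ x ∈ M, r.observeProb O M x := by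
    rw [← sum_observeProb r O hpi M, ← Finset.sum_add_sum_compl M]; ring
  induction n with
  | zero => simp [outputProb]
  | succ n ih =>
    rw [List.replicate_succ]
    simp only [outputProb, hc]
    rw [Finset.sum_add_distrib, ← Finset.mul_sum, ih, Finset.sum_ite_mem, Finset.inter_self]
    ring

end Success

/-! ### Choice of the parameters and the total cost -/

section Complexity

/-- The base 9 comes from the two triplings between consecutive stages; rounding up loses at most a
factor 9. -/
theorem exists_level_bound {ε : ℝ} (hε : 0 < ε) (hε1 : ε ≤ 1) :
    ∃ L : ℕ, 1 ≤ 9 ^ L * √ε ∧ (9 : ℝ) ^ L ≤ 9 * (1 / √ε) := by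
  have h0 : 0 < √ε := Real.sqrt_pos.2 hε
  have h1 : 1 ≤ 1 / √ε := (one_le_div h0).2 (Real.sqrt_le_one.2 hε1)
  obtain ⟨n, hn, hn'⟩ := exists_nat_pow_near h1 (by norm_num : (1 : ℝ) < 9)
  refine ⟨n + 1, ?_, ?_⟩
  · exact ((div_lt_iff₀ h0).1 hn').le
  · rw [pow_succ]; linarith

theorem exists_clock_bound {δ : ℝ} (hδ : 0 < δ) (hδ1 : δ ≤ 1) :
    ∃ N₀ : ℕ, 16 ≤ N₀ * √δ ∧ (N₀ : ℝ) ≤ 17 * (1 / √δ) ∧ 1 ≤ N₀ := by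
  have h0 : 0 < √δ := Real.sqrt_pos.2 hδ
  have h1 : 1 ≤ 1 / √δ := (one_le_div h0).2 (Real.sqrt_le_one.2 hδ1)
  refine ⟨⌈16 * (1 / √δ)⌉₊, ?_, ?_, Nat.one_le_ceil_iff.2 (by positivity)⟩
  · calc (16 : ℝ) = 16 * (1 / √δ) * √δ := by field_simp
      _ ≤ _ := by gcongr; exact Nat.le_ceil _
  · have := (Nat.ceil_lt_add_one (by positivity : 0 ≤ 16 * (1 / √δ))).le
    linarith

/-- The largest coefficient is that of abU, namely 81/8 · 340 < 3443; 4000 also absorbs the single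
U. -/
theorem searchRun_cost_bound {a b S U C N₀ t : ℝ} (ha : 1 ≤ a) (hb : 1 ≤ b) (hS : 0 ≤ S)
    (hU : 0 ≤ U) (hC : 0 ≤ C) (ht : t ≤ 9 * a) (hN : N₀ ≤ 17 * b) (hN0 : 0 ≤ N₀) :
    S + U + t * 9 / 8 * (20 * N₀ * U + 2 * C) + C ≤ 4000 * (S + a * (b * U + C)) := by
  have h1 : U ≤ a * (b * U) := by
    calc U = 1 * (1 * U) := by ring
      _ ≤ _ := by gcongr
  have h2 : C ≤ a * C := le_mul_of_one_le_left hC ha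
  have h3 : t * 9 / 8 * (20 * N₀ * U + 2 * C) ≤ 9 * a * 9 / 8 * (20 * (17 * b) * U + 2 * C) := by
    gcongr
  nlinarith

theorem cost_replicate (S U C : ℝ) (n : ℕ) (r : Run) :
    SearchAlgorithm.cost S U C (List.replicate n r) = n * r.cost S U C := by
  simp [SearchAlgorithm.cost]

end Complexity

end

end QuantumSearch

theorem mainTheorem2 (η : ℝ) (hη : 0 < η) :
    ∃ κ : ℝ, 0 < κ ∧ ∀ δ ε : ℝ, 0 < δ → 0 < ε →
      ∃ alg : QuantumSearch.SearchAlgorithm,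
        (∀ S U C : ℝ, 0 ≤ S → 0 ≤ U → 0 ≤ C →
          alg.cost S U C ≤ κ * (S + 1 / √ε * (1 / √δ * U + C))) ∧
        ∀ (X : Type*) [Fintype X] [DecidableEq X] (D : Type*) (d : X → D) (zero : X)
          (P : Matrix X X ℝ) (pi : X → ℝ) (M : Finset X),
          P ∈ Matrix.rowStochastic ℝ X →
          P.IsIrreducible →
          QuantumSearch.IsStationaryDistribution P pi →
          QuantumSearch.HasExactlyOneUnitSingularValue (QuantumSearch.discriminant P pi) →
          QuantumSearch.singularValueGap (QuantumSearch.discriminant P pi) = δ →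
          (M.Nonempty → ε ≤ ∑ x ∈ M, pi x) →
          ∀ O : QuantumSearch.UpdateOracle d zero P pi,
            1 - η ≤ alg.successProb O M := by
  -- A run misses with probability at most 1 - 1/32², so r runs all miss with probability below η.
  obtain ⟨r, hr⟩ := exists_pow_lt_of_lt_one hη (by norm_num : (1 - (1 / 32) ^ 2 : ℝ) < 1)
  -- The summand 1 keeps the constant positive when r = 0, which can occur for η > 1.
  refine ⟨r * 4000 + 1, by positivity, fun δ ε hδ hε => ?_⟩
  by_cases hle : δ ≤ 1 ∧ ε ≤ 1
  · obtain ⟨hδ1, hε1⟩ := hle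
    obtain ⟨L, hL, hL'⟩ := QuantumSearch.exists_level_bound hε hε1
    obtain ⟨N₀, hN, hN', hN1⟩ := QuantumSearch.exists_clock_bound hδ hδ1
    refine ⟨List.replicate r (QuantumSearch.searchRun L N₀), fun S U C hS hU hC => ?_, ?_⟩
    · have ha : 1 ≤ 1 / √ε := (one_le_div (Real.sqrt_pos.2 hε)).2 (Real.sqrt_le_one.2 hε1)
      have hb : 1 ≤ 1 / √δ := (one_le_div (Real.sqrt_pos.2 hδ)).2 (Real.sqrt_le_one.2 hδ1)
      have h1 := QuantumSearch.cost_searchRun_le (S := S) hU hC (L := L) hN1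
      have h2 := QuantumSearch.searchRun_cost_bound ha hb hS hU hC hL' hN' (Nat.cast_nonneg N₀)
      rw [← pow_succ] at h2
      have h3 : 0 ≤ S + 1 / √ε * (1 / √δ * U + C) := by positivity
      rw [QuantumSearch.cost_replicate]
      calc r * (QuantumSearch.searchRun L N₀).cost S U C
          ≤ r * (4000 * (S + 1 / √ε * (1 / √δ * U + C))) := by gcongr; exact h1.trans h2
        _ ≤ _ := by rw [add_mul, one_mul, mul_assoc]; linarith
    · intro X _ _ D d zero P pi M hP hirr hpi _ hgap hM O
      rcases M.eq_empty_or_nonempty with rfl | hne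
      · rw [QuantumSearch.successProb_empty _ O hpi]; linarith
      · have hq := QuantumSearch.sum_observeProb_searchRun_ge O hP hpi (hpi.pos hirr) hgap hδ
          (hM hne) hL hN
        have hq1 : ∑ x ∈ M, (QuantumSearch.searchRun L N₀).observeProb O M x ≤ 1 := by
          rw [← QuantumSearch.sum_observeProb (QuantumSearch.searchRun L N₀) O hpi M]
          exact Finset.sum_le_sum_of_subset_of_nonneg (Finset.subset_univ M)
            fun x _ _ => QuantumSearch.observeProb_nonneg _ O M x
        rw [QuantumSearch.successProb_of_nonempty _ O hne,
          QuantumSearch.sum_outputProb_replicate _ O hpi]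
        have := pow_le_pow_left₀ (by linarith) (sub_le_sub_left hq 1) r
        linarith
  -- If δ > 1 or ε > 1, no admissible instance has a marked element, and the algorithm without runs
  -- is correct at cost 0.
  · refine ⟨[], fun S U C hS hU hC => ?_, ?_⟩
    · have : 0 ≤ S + 1 / √ε * (1 / √δ * U + C) := by positivity
      simp only [QuantumSearch.SearchAlgorithm.cost, List.map_nil, List.sum_nil]
      positivity
    · intro X _ _ D d zero P pi M hP hirr hpi _ hgap hM O
      rcases M.eq_empty_or_nonempty with rfl | hne
      · rw [QuantumSearch.successProb_empty _ O hpi]; linarith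
      · refine absurd ⟨QuantumSearch.gap_le_one hgap, (hM hne).trans ?_⟩ hle
        rw [← hpi.1.2]
        exact Finset.sum_le_sum_of_subset_of_nonneg (Finset.subset_univ M)
          fun x _ _ => hpi.1.1 x
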